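/- Let $V$ be a finite-dimensional $\mathbb Q$-vector space carrying a Hodge structure of weight $2$ of K3 type, i.e. $V_{\mathbb C}=V^{2,0}\oplus V^{1,1}\oplus V^{0,2}$ with $\dim_{\mathbb C}V^{2,0}=1$, and let $\phi\colon V\times V\to\mathbb Q$ be a bilinear form such that $\phi$ or $-\phi$ is a polarization of it (for example, $V$ the rational transcendental lattice of a complex projective K3 surface with its intersection form). Let $C(V)$ be the Clifford algebra of $(V,\phi)$, with $v^2=\phi(v,v)$, let $C^+(V)$ be its even part, let $\mathrm{CSpin}(\phi)=\{g\in C^+(V)^* : gVg^{-1}\subset V\}$, considered as an algebraic group over $\mathbb Q$, and let $\rho\colon \mathrm{CSpin}(\phi)\to SO(\phi)\subset GL(V)$, $g\mapsto(v\mapsto gvg^{-1})$, and $\sigma\colon \mathrm{CSpin}(\phi)\hookrightarrow GL(C^+(V))$, $g\mapsto(x\mapsto gx)$, be the vector and the spin representation. Choose $\omega=e_1+ie_2\in V^{2,0}$, $\omega\neq 0$, with $e_1,e_2\in V_{\mathbb R}$, and put $J=\phi(e_1,e_1)^{-1}e_1e_2\in C^+(V)_{\mathbb R}$; then $J^2=-1$,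 and the Kuga–Satake Hodge structure of weight $1$ on $C^+(V)$ is the one whose $(1,0)$- and $(0,1)$-parts are the $i$- and $(-i)$-eigenspaces of $x\mapsto Jx$ on $C^+(V)_{\mathbb C}$. For a rational Hodge structure $W$ let $h\colon\mathbb C^*\to GL(W_{\mathbb R})$ be the homomorphism for which $h(z)$ acts on $W^{p,q}$ as multiplication by $z^p\bar z^q$. Let $MT(W)$, the Mumford–Tate group, be the smallest algebraic subgroup of $GL(W)$ defined over $\mathbb Q$ whose real points contain $h(\mathbb C^*)$, and let $\mathrm{Hdg}(W)$, the special Mumford–Tate group or Hodge group, be the smallest one whose real points contain $h(S^1)$, where $S^1=\{z:|z|=1\}$. Then $$MT(C^+(V))=\sigma\bigl(\rho^{-1}(\mathrm{Hdg}(V))\bigr).$$ That is, the Mumford–Tate group of the Kuga–Satake Hodge structure of weight $1$ on $C^+(V)$ is the preimage under $\rho\colon\mathrm{CSpin}(\phi)\to SO(\phi)$ of the (special) Mumford–Tate group of the Hodge structure of weight $2$ on $V$. -/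

import Mathlib

open scoped TensorProduct

noncomputable section

namespace KugaSatake

/-! ### Complexification of a rational vector space -/

section Complexification

variable (W : Type*) [AddCommGroup W] [Module ℚ W]

/-- Complex conjugation `z ⊗ w ↦ conj z ⊗ w` on `ℂ ⊗ W`. -/
def conjC : ℂ ⊗[ℚ] W →ₗ[ℚ] ℂ ⊗[ℚ] W :=
  LinearMap.rTensor W (Complex.conjAe.toLinearMap.restrictScalars ℚ)

variable {W}

@[simp] lemma conjC_tmul (z : ℂ) (w : W) :
    conjC W (z ⊗ₜ w) = (starRingEnd ℂ z) ⊗ₜ w := rfl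

lemma conjC_smul (z : ℂ) (x : ℂ ⊗[ℚ] W) :
    conjC W (z • x) = (starRingEnd ℂ z) • conjC W x := by
  induction x using TensorProduct.induction_on with
  | zero => simp
  | tmul a w => simp [TensorProduct.smul_tmul']
  | add x y hx hy => simp only [smul_add, map_add, hx, hy]

@[simp] lemma conjC_conjC (x : ℂ ⊗[ℚ] W) : conjC W (conjC W x) = x := by
  induction x using TensorProduct.induction_on with
  | zero => simp
  | tmul a w => simp
  | add x y hx hy => simp only [map_add, hx, hy]

/-- The real part of a vector of `ℂ ⊗ W`. -/
def reC (x : ℂ ⊗[ℚ] W) : ℂ ⊗[ℚ] W := (2 : ℂ)⁻¹ • (x + conjC W x)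

/-- The imaginary part of a vector of `ℂ ⊗ W`, so that `x = reC x + i imC x`. -/
def imC (x : ℂ ⊗[ℚ] W) : ℂ ⊗[ℚ] W := (2 * Complex.I)⁻¹ • (x - conjC W x)

lemma conjC_reC (x : ℂ ⊗[ℚ] W) : conjC W (reC x) = reC x := by
  have h2 : starRingEnd ℂ 2 = 2 := Complex.conj_ofNat 2
  simp [reC, conjC_smul, h2, add_comm]

lemma conjC_imC (x : ℂ ⊗[ℚ] W) : conjC W (imC x) = imC x := by
  simp only [imC, conjC_smul, map_sub, conjC_conjC, map_inv₀, map_mul, Complex.conj_I]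
  rw [← neg_sub x (conjC W x), smul_neg, ← neg_smul]
  have h2 : starRingEnd ℂ 2 = 2 := Complex.conj_ofNat 2
  congr 1
  simp [h2]

end Complexification

/-! ### Algebraic subgroups of `GL(W)` defined over `ℚ`, through their complex points -/

section AlgebraicSubgroups

variable (W : Type*) [AddCommGroup W] [Module ℚ W]

/-- The group `GL(W)(ℂ) = GL(ℂ ⊗ W)`. -/
abbrev GLC : Type _ := LinearMap.GeneralLinearGroup ℂ (ℂ ⊗[ℚ] W)

variable {W}

/-- The value at `g ∈ GL(W)(ℂ)` of the matrix coefficient attached to `w ∈ W` and `ℓ ∈ W*`.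
When `w` and `ℓ` run through a basis and its dual basis these are the matrix entries of `g`. -/
def matrixCoeff (g : GLC W) (c : W × Module.Dual ℚ W) : ℂ :=
  Module.Dual.baseChange ℂ c.2 ((g : Module.End ℂ (ℂ ⊗[ℚ] W)) (1 ⊗ₜ c.1))

/-- A subgroup of `GL(W)(ℂ)` is (the group of complex points of) an algebraic subgroup of `GL(W)`
defined over `ℚ` if it is the zero locus in `GL(W)(ℂ)` of a set of polynomials
with rational coefficients in the matrix coefficients. -/
def IsAlgebraicOverQ (G : Subgroup (GLC W)) : Prop :=
  ∃ S : Set (MvPolynomial (W × Module.Dual ℚ W) ℚ),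
    ∀ g : GLC W, g ∈ G ↔ ∀ P ∈ S, MvPolynomial.aeval (matrixCoeff g) P = 0

/-- The smallest algebraic subgroup of `GL(W)` defined over `ℚ` that contains the set `T` of
complex points. -/
def algebraicHull (T : Set (GLC W)) : Subgroup (GLC W) :=
  sInf {G | IsAlgebraicOverQ G ∧ T ⊆ (G : Set (GLC W))}

end AlgebraicSubgroups

/-! ### Rational Hodge structures -/

/-- A rational Hodge structure of weight `n` on `W`: a decomposition of `ℂ ⊗ W` into the pieces
`piece p = W^{p, n - p}`, with `W^{n - p, p}` the conjugate of `W^{p, n - p}`. -/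
structure HodgeStructure (W : Type*) [AddCommGroup W] [Module ℚ W] (n : ℤ) where
  piece : ℤ → Submodule ℂ (ℂ ⊗[ℚ] W)
  isInternal : DirectSum.IsInternal piece
  conj_mem : ∀ (p : ℤ) (x : ℂ ⊗[ℚ] W), x ∈ piece p → conjC W x ∈ piece (n - p)

namespace HodgeStructure

variable {W : Type*} [AddCommGroup W] [Module ℚ W] {n : ℤ} (H : HodgeStructure W n)

lemma sum_bijective : Function.Bijective (DirectSum.coeLinearMap H.piece) := H.isInternal

/-- The isomorphism `⨁ p, W^{p, n - p} ≃ ℂ ⊗ W`. -/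
def sumEquiv : (DirectSum ℤ fun p => H.piece p) ≃ₗ[ℂ] ℂ ⊗[ℚ] W :=
  LinearEquiv.ofBijective (DirectSum.coeLinearMap H.piece) H.sum_bijective

/-- Multiplication by `z ^ p * (conj z) ^ (n - p)` on each summand `W^{p, n - p}`. -/
def sumAct (z : ℂ) : Module.End ℂ (DirectSum ℤ fun p => H.piece p) :=
  DirectSum.lmap fun p => (z ^ p * (starRingEnd ℂ z) ^ (n - p)) • LinearMap.id

/-- The homomorphism `h : ℂˣ → GL(ℂ ⊗ W)` attached to the Hodge structure; `h z` acts on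
`W^{p,q}` as multiplication by `z ^ p * (conj z) ^ q`. -/
def deligneHom : ℂˣ →* GLC W :=
  MonoidHom.toHomUnits
    { toFun := fun z => H.sumEquiv.conj (H.sumAct z)
      map_one' := by
        have h : H.sumAct ((1 : ℂˣ) : ℂ) = LinearMap.id := by
          ext p x : 2
          simp [sumAct]
        rw [h, LinearEquiv.conj_id]; rfl
      map_mul' := fun z w => by
        have h : H.sumAct ((z * w : ℂˣ) : ℂ) = H.sumAct z * H.sumAct w := by
          ext p x : 2
          simp only [sumAct, Units.val_mul, LinearMap.comp_apply, Module.End.mul_apply,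
            DirectSum.lmap_lof, LinearMap.smul_apply, LinearMap.id_apply, map_smul, smul_smul]
          congr 1
          rw [map_mul, mul_zpow, mul_zpow]
          ring
        rw [h]
        exact LinearEquiv.conj_comp _ _ _ }

lemma deligneHom_apply (z : ℂˣ) (p : ℤ) (x : ℂ ⊗[ℚ] W) (hx : x ∈ H.piece p) :
    (H.deligneHom z : Module.End ℂ (ℂ ⊗[ℚ] W)) x =
      ((z : ℂ) ^ p * (starRingEnd ℂ (z : ℂ)) ^ (n - p)) • x := by
  have h : H.sumEquiv (DirectSum.lof ℂ ℤ (fun p => H.piece p) p ⟨x, hx⟩) = x := by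
    rw [sumEquiv, LinearEquiv.ofBijective_apply, DirectSum.coeLinearMap_lof]
  conv_lhs => rw [← h]
  change H.sumEquiv (H.sumAct z (H.sumEquiv.symm (H.sumEquiv _))) = _
  rw [LinearEquiv.symm_apply_apply, sumAct, DirectSum.lmap_lof, LinearMap.smul_apply, map_smul,
    map_smul, LinearMap.id_apply, h]

/-- The Mumford-Tate group of the Hodge structure (its group of complex points): the smallest
algebraic subgroup of `GL(W)` over `ℚ` that contains `h(ℂˣ)`. -/
def mumfordTate : Subgroup (GLC W) :=
  algebraicHull (Set.range H.deligneHom)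

/-- The special Mumford-Tate group, or Hodge group, of the Hodge structure (its group of complex
points): the smallest algebraic subgroup of `GL(W)` over `ℚ` that contains `h(S¹)`. -/
def hodgeGroup : Subgroup (GLC W) :=
  algebraicHull (H.deligneHom '' {z : ℂˣ | ‖(z : ℂ)‖ = 1})

/-- A rational bilinear form `φ` is a polarization of the Hodge structure of weight `n` if it is
`(-1) ^ n`-symmetric, `W^{p,q}` is orthogonal to `W^{r,s}` unless `(r,s) = (q,p)`, and
`i ^ (p - q) φ(x, conj x) > 0` for every nonzero `x` in `W^{p,q}`. -/
structure IsPolarization (φ : LinearMap.BilinForm ℚ W) : Prop where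
  symm : ∀ x y, φ x y = (-1) ^ n * φ y x
  orthogonal : ∀ p r : ℤ, p + r ≠ n → ∀ x ∈ H.piece p, ∀ y ∈ H.piece r,
    φ.baseChange ℂ x y = 0
  pos : ∀ p : ℤ, ∀ x ∈ H.piece p, x ≠ 0 →
    0 < (Complex.I ^ (p - (n - p)) * φ.baseChange ℂ x (conjC W x)).re

/-- A weight `2` Hodge structure of K3 type: the only Hodge types are `(2,0)`, `(1,1)` and `(0,2)`,
and `W^{2,0}` is a line. -/
structure IsK3Type (H : HodgeStructure W 2) : Prop where
  effective : ∀ p : ℤ, p ≠ 0 → p ≠ 1 → p ≠ 2 → H.piece p = ⊥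
  finrank_two_zero : Module.finrank ℂ (H.piece 2) = 1

end HodgeStructure

/-! ### Clifford algebras, the group `CSpin` and its two representations -/

section Clifford

variable {V : Type*} [AddCommGroup V] [Module ℚ V] (φ : LinearMap.BilinForm ℚ V)

/-- The Clifford algebra `C(V)` of `(V, φ)`, with relations `v ^ 2 = φ(v, v)`. -/
abbrev Cl : Type _ := CliffordAlgebra φ.toQuadraticMap

/-- The even Clifford algebra `C⁺(V)`. -/
abbrev ClEven : Type _ := CliffordAlgebra.even φ.toQuadraticMap

/-- The inclusion of `V` in `C(V)`, over `ℂ`. -/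
def iotaC : ℂ ⊗[ℚ] V →ₗ[ℂ] ℂ ⊗[ℚ] Cl φ :=
  (CliffordAlgebra.ι φ.toQuadraticMap).baseChange ℂ

/-- The inclusion of `C⁺(V)` in `C(V)`, over `ℂ`. -/
def evenC : ℂ ⊗[ℚ] ClEven φ →ₐ[ℂ] ℂ ⊗[ℚ] Cl φ :=
  Algebra.TensorProduct.map (AlgHom.id ℂ ℂ) (CliffordAlgebra.even φ.toQuadraticMap).val

/-- The product `V × V → C⁺(V)`, over `ℂ`. -/
def mulC : (ℂ ⊗[ℚ] V) →ₗ[ℂ] (ℂ ⊗[ℚ] V) →ₗ[ℂ] ℂ ⊗[ℚ] ClEven φ :=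
  LinearMap.BilinMap.baseChange ℂ (CliffordAlgebra.even.ι φ.toQuadraticMap).bilin

lemma evenC_mulC (v w : ℂ ⊗[ℚ] V) : evenC φ (mulC φ v w) = iotaC φ v * iotaC φ w := by
  induction v using TensorProduct.induction_on with
  | zero => simp
  | add x y hx hy => simp only [map_add, LinearMap.add_apply, hx, hy, add_mul]
  | tmul a v =>
    induction w using TensorProduct.induction_on with
    | zero => simp
    | add x y hx hy => simp only [map_add, hx, hy, mul_add]
    | tmul b w => simp [evenC, mulC, iotaC]; rfl

lemma iotaC_mul_add_swap (v w : ℂ ⊗[ℚ] V) :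
    iotaC φ v * iotaC φ w + iotaC φ w * iotaC φ v =
      algebraMap ℂ _ (φ.baseChange ℂ v w + φ.baseChange ℂ w v) := by
  induction v using TensorProduct.induction_on with
  | zero => simp
  | add x y hx hy =>
    simp only [map_add, LinearMap.add_apply, add_mul, mul_add] at hx hy ⊢
    rw [add_add_add_comm, hx, hy, add_add_add_comm]
  | tmul a v =>
    induction w using TensorProduct.induction_on with
    | zero => simp
    | add x y hx hy =>
      simp only [map_add, LinearMap.add_apply, add_mul, mul_add] at hx hy ⊢
      rw [add_add_add_comm, hx, hy, add_add_add_comm]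
    | tmul b w =>
      simp only [iotaC, LinearMap.baseChange_tmul, Algebra.TensorProduct.tmul_mul_tmul,
        LinearMap.BilinForm.baseChange_tmul]
      rw [mul_comm b a, ← TensorProduct.tmul_add, CliffordAlgebra.ι_mul_ι_add_swap,
        Algebra.algebraMap_eq_smul_one, TensorProduct.tmul_smul, TensorProduct.smul_tmul',
        Algebra.TensorProduct.algebraMap_apply, ← add_smul]
      congr 2
      simp [QuadraticMap.polar]
      ring

lemma iota_injective : Function.Injective (CliffordAlgebra.ι φ.toQuadraticMap) := by
  have : Invertible (2 : ℚ) := invertibleOfNonzero two_ne_zero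
  intro v w h
  have h2 := congrArg (CliffordAlgebra.equivExterior φ.toQuadraticMap) h
  simp only [CliffordAlgebra.equivExterior, CliffordAlgebra.changeFormEquiv_apply,
    CliffordAlgebra.changeForm_ι] at h2
  exact ExteriorAlgebra.ι_inj ℚ v w |>.mp h2

lemma iotaC_injective : Function.Injective (iotaC φ) :=
  Module.Flat.lTensor_preserves_injective_linearMap (M := ℂ)
    (CliffordAlgebra.ι φ.toQuadraticMap) (iota_injective φ)

lemma evenC_injective : Function.Injective (evenC φ) :=
  Module.Flat.lTensor_preserves_injective_linearMap (M := ℂ)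
    (CliffordAlgebra.even φ.toQuadraticMap).val.toLinearMap Subtype.val_injective

/-- For `g ∈ C⁺(V)ˣ` (over `ℂ`), the map `x ↦ g x g⁻¹` on `C(V)` (over `ℂ`). -/
def conjBy (g : (ℂ ⊗[ℚ] ClEven φ)ˣ) : ℂ ⊗[ℚ] Cl φ →ₗ[ℂ] ℂ ⊗[ℚ] Cl φ :=
  LinearMap.mulLeft ℂ (evenC φ g) ∘ₗ LinearMap.mulRight ℂ (evenC φ (g⁻¹ : (ℂ ⊗[ℚ] ClEven φ)ˣ))

lemma conjBy_apply (g : (ℂ ⊗[ℚ] ClEven φ)ˣ) (x : ℂ ⊗[ℚ] Cl φ) :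
    conjBy φ g x = evenC φ g * (x * evenC φ (g⁻¹ : (ℂ ⊗[ℚ] ClEven φ)ˣ)) := rfl

lemma conjBy_one (x : ℂ ⊗[ℚ] Cl φ) : conjBy φ 1 x = x := by
  simp [conjBy_apply]

lemma conjBy_mul (g k : (ℂ ⊗[ℚ] ClEven φ)ˣ) (x : ℂ ⊗[ℚ] Cl φ) :
    conjBy φ (g * k) x = conjBy φ g (conjBy φ k x) := by
  simp [conjBy_apply, mul_assoc]

variable [FiniteDimensional ℚ V]

/-- The group `CSpin(φ)` (its complex points): the `g ∈ C⁺(V)ˣ` such that `g V g⁻¹ ⊆ V`. -/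
def cSpin : Subgroup (ℂ ⊗[ℚ] ClEven φ)ˣ where
  carrier := {g | (LinearMap.range (iotaC φ)).map (conjBy φ g) ≤ LinearMap.range (iotaC φ)}
  one_mem' := by
    rintro _ ⟨x, hx, rfl⟩
    rwa [conjBy_one]
  mul_mem' := fun {g k} hg hk => by
    rintro _ ⟨x, hx, rfl⟩
    rw [conjBy_mul]
    exact hg ⟨_, hk ⟨x, hx, rfl⟩, rfl⟩
  inv_mem' := fun {g} hg => by
    have hinj : Function.Injective (conjBy φ g) := fun x y h => by
      have := congrArg (conjBy φ g⁻¹) h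
      rwa [← conjBy_mul, ← conjBy_mul, inv_mul_cancel, conjBy_one, conjBy_one] at this
    have heq : (LinearMap.range (iotaC φ)).map (conjBy φ g) = LinearMap.range (iotaC φ) :=
      Submodule.eq_of_le_of_finrank_eq hg (Submodule.equivMapOfInjective _ hinj _).finrank_eq.symm
    rintro _ ⟨x, hx, rfl⟩
    rw [← heq] at hx
    obtain ⟨y, hy, rfl⟩ := hx
    rwa [← conjBy_mul, inv_mul_cancel, conjBy_one]

/-- The inclusion `V → C(V)` as an isomorphism onto its image, over `ℂ`. -/
def iotaEquiv : (ℂ ⊗[ℚ] V) ≃ₗ[ℂ] LinearMap.range (iotaC φ) :=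
  LinearEquiv.ofInjective (iotaC φ) (iotaC_injective φ)

lemma conjBy_mem (g : cSpin φ) (x : ℂ ⊗[ℚ] Cl φ) (hx : x ∈ LinearMap.range (iotaC φ)) :
    conjBy φ g x ∈ LinearMap.range (iotaC φ) :=
  g.2 ⟨x, hx, rfl⟩

/-- The endomorphism `v ↦ g v g⁻¹` of `V`, over `ℂ`, for `g ∈ CSpin(φ)`. -/
def rhoEnd (g : cSpin φ) : Module.End ℂ (ℂ ⊗[ℚ] V) :=
  (iotaEquiv φ).symm.conj ((conjBy φ g).restrict (conjBy_mem φ g))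

lemma iotaC_rhoEnd (g : cSpin φ) (v : ℂ ⊗[ℚ] V) :
    iotaC φ (rhoEnd φ g v) = conjBy φ g (iotaC φ v) := by
  have h : ∀ y : LinearMap.range (iotaC φ), iotaC φ ((iotaEquiv φ).symm y) = y := fun y =>
    congrArg Subtype.val ((iotaEquiv φ).apply_symm_apply y)
  exact h _

/-- The vector representation `ρ : CSpin(φ) → GL(V)`, `g ↦ (v ↦ g v g⁻¹)`, on complex points. -/
def rho : cSpin φ →* GLC V :=
  MonoidHom.toHomUnits
    { toFun := rhoEnd φ
      map_one' := by
        apply LinearMap.ext; intro v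
        apply iotaC_injective φ
        simp [iotaC_rhoEnd, conjBy_one]
      map_mul' := fun g k => by
        apply LinearMap.ext; intro v
        apply iotaC_injective φ
        simp [iotaC_rhoEnd, conjBy_mul] }

/-- The spin representation `σ : CSpin(φ) → GL(C⁺(V))`, `g ↦ (x ↦ g x)`, on complex points. -/
def sigma : cSpin φ →* GLC (ClEven φ) :=
  (Units.map (Algebra.lmul ℂ (ℂ ⊗[ℚ] ClEven φ)).toRingHom.toMonoidHom).comp (cSpin φ).subtype

end Clifford

/-! ### The Kuga-Satake Hodge structure -/

section KS

variable {V : Type*} [AddCommGroup V] [Module ℚ V]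
variable (φ : LinearMap.BilinForm ℚ V)

/-- The element `J ∈ C⁺(V)` (over `ℝ`) that defines the Kuga-Satake complex structure.
For `ω = e₁ + i e₂` spanning `V^{2,0}`, with `e₁, e₂` real, one has
`φ(e₁, e₂) = 0` and `φ(e₁, e₁) = φ(e₂, e₂) = ε c ^ 2`, with `ε = ±1` and `c` real; with
`f₁ = e₁ / c`, `f₂ = e₂ / c`, the element is `J = φ(e₁, e₁)⁻¹ e₁ e₂ = ε f₁ f₂`. -/
def complexStructure (ω : ℂ ⊗[ℚ] V) : ℂ ⊗[ℚ] ClEven φ :=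
  (φ.baseChange ℂ (reC ω) (reC ω))⁻¹ • mulC φ (reC ω) (imC ω)

/-- The Hodge pieces of a complex structure `J`: `(1,0)` is the `i`-eigenspace of `x ↦ J x`
and `(0,1)` is its `(-i)`-eigenspace. -/
def ksPiece (ω : ℂ ⊗[ℚ] V) (p : ℤ) : Submodule ℂ (ℂ ⊗[ℚ] ClEven φ) :=
  if p = 1 then
    Module.End.eigenspace (LinearMap.mulLeft ℂ (complexStructure φ ω)) Complex.I
  else if p = 0 then
    Module.End.eigenspace (LinearMap.mulLeft ℂ (complexStructure φ ω)) (-Complex.I)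
  else ⊥

lemma conjC_mul {A : Type*} [Ring A] [Algebra ℚ A] (x y : ℂ ⊗[ℚ] A) :
    conjC A (x * y) = conjC A x * conjC A y := by
  induction x using TensorProduct.induction_on with
  | zero => simp
  | add x x' hx hy => simp only [map_add, add_mul, hx, hy]
  | tmul a v =>
    induction y using TensorProduct.induction_on with
    | zero => simp
    | add x y hx hy => simp only [map_add, hx, hy, mul_add]
    | tmul b w => simp

lemma conjC_mulC (v w : ℂ ⊗[ℚ] V) :
    conjC _ (mulC φ v w) = mulC φ (conjC V v) (conjC V w) := by
  induction v using TensorProduct.induction_on with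
  | zero => simp
  | add x y hx hy => simp only [map_add, LinearMap.add_apply, hx, hy]
  | tmul a v =>
    induction w using TensorProduct.induction_on with
    | zero => simp
    | add x y hx hy => simp only [map_add, hx, hy]
    | tmul b w => simp [mulC]

lemma conj_baseChange (v w : ℂ ⊗[ℚ] V) :
    starRingEnd ℂ (φ.baseChange ℂ v w) = φ.baseChange ℂ (conjC V v) (conjC V w) := by
  induction v using TensorProduct.induction_on with
  | zero => simp
  | add x y hx hy => simp only [map_add, LinearMap.add_apply, hx, hy]
  | tmul a v =>
    induction w using TensorProduct.induction_on with
    | zero => simp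
    | add x y hx hy => simp only [map_add, hx, hy]
    | tmul b w => simp [Rat.smul_def]

lemma conjC_complexStructure (ω : ℂ ⊗[ℚ] V) :
    conjC _ (complexStructure φ ω) = complexStructure φ ω := by
  rw [complexStructure, conjC_smul, conjC_mulC, map_inv₀, conj_baseChange, conjC_reC, conjC_imC]

/-- `J ^ 2 = -1` as soon as `φ` is symmetric, `ω` and `conj ω` are isotropic and
`φ(ω, conj ω) ≠ 0`. -/
lemma complexStructure_sq (ω : ℂ ⊗[ℚ] V) (hs : ∀ x y, φ x y = φ y x)
    (h1 : φ.baseChange ℂ ω ω = 0) (h2 : φ.baseChange ℂ (conjC V ω) (conjC V ω) = 0)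
    (h3 : φ.baseChange ℂ ω (conjC V ω) ≠ 0) :
    complexStructure φ ω * complexStructure φ ω = -1 := by
  have hsC : ∀ x y, φ.baseChange ℂ x y = φ.baseChange ℂ y x := by
    have h : LinearMap.IsSymm φ := ⟨fun x y => hs x y⟩
    exact fun x y => (LinearMap.BilinForm.IsSymm.baseChange ℂ h).eq x y
  set c := φ.baseChange ℂ ω (conjC V ω) with hc
  have h4 : φ.baseChange ℂ (conjC V ω) ω = c := hsC _ _
  have a11 : φ.baseChange ℂ (reC ω) (reC ω) = c / 2 := by
    simp only [reC, map_smul, map_add, LinearMap.smul_apply, LinearMap.add_apply, h1, h2, h4,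
      ← hc, smul_eq_mul]
    ring
  have a22 : φ.baseChange ℂ (imC ω) (imC ω) = c / 2 := by
    simp only [imC, map_smul, map_sub, LinearMap.smul_apply, LinearMap.sub_apply, h1, h2, h4,
      ← hc, smul_eq_mul]
    field_simp
    rw [Complex.I_sq]
    ring
  have a12 : φ.baseChange ℂ (reC ω) (imC ω) = 0 := by
    simp only [reC, imC, map_smul, map_sub, map_add, LinearMap.smul_apply, LinearMap.add_apply,
      h1, h2, h4, ← hc, smul_eq_mul]
    ring
  have a21 : φ.baseChange ℂ (imC ω) (reC ω) = 0 := by rw [hsC, a12]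
  have sq : ∀ v, iotaC φ v * iotaC φ v = algebraMap ℂ _ (φ.baseChange ℂ v v) := fun v => by
    have h := iotaC_mul_add_swap φ v v
    rw [← two_smul ℂ, ← two_mul, map_mul, ← Algebra.smul_def] at h
    exact smul_right_injective _ (two_ne_zero (α := ℂ)) h
  have r11 := sq (reC ω)
  have r22 := sq (imC ω)
  have r12 := iotaC_mul_add_swap φ (reC ω) (imC ω)
  rw [a11] at r11
  rw [a22] at r22
  rw [a12, a21, add_zero, map_zero] at r12
  have r21 : iotaC φ (imC ω) * iotaC φ (reC ω) = -(iotaC φ (reC ω) * iotaC φ (imC ω)) :=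
    eq_neg_of_add_eq_zero_right r12
  apply evenC_injective φ
  rw [complexStructure, a11, map_mul, map_smul, evenC_mulC, map_neg, map_one, smul_mul_smul_comm]
  have : iotaC φ (reC ω) * iotaC φ (imC ω) * (iotaC φ (reC ω) * iotaC φ (imC ω)) =
      -(algebraMap ℂ _ ((c / 2) * (c / 2))) := by
    rw [mul_assoc, ← mul_assoc (iotaC φ (imC ω)), r21, neg_mul, mul_neg, mul_assoc, r22,
      ← mul_assoc, r11, map_mul]
  have hcc : (c / 2)⁻¹ * (c / 2)⁻¹ * (c / 2 * (c / 2)) = 1 := by field_simp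
  rw [this, smul_neg, Algebra.smul_def, ← map_mul, hcc, map_one]

lemma complexStructure_sq_of_polarization (H : HodgeStructure V 2)
    (hφ : H.IsPolarization φ ∨ H.IsPolarization (-φ))
    (ω : ℂ ⊗[ℚ] V) (hω : ω ∈ H.piece 2) (hω0 : ω ≠ 0) :
    complexStructure φ ω * complexStructure φ ω = -1 := by
  have hc0 : conjC V ω ∈ H.piece 0 := H.conj_mem 2 ω hω
  have hneg : (-φ).baseChange ℂ = -(φ.baseChange ℂ) := by
    ext; simp
  rcases hφ with h | h
  · refine complexStructure_sq φ ω (fun x y => by simpa using h.symm x y)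
      (h.orthogonal 2 2 (by norm_num) _ hω _ hω) (h.orthogonal 0 0 (by norm_num) _ hc0 _ hc0) ?_
    intro h0
    have := h.pos 2 ω hω hω0
    simp [h0] at this
  · refine complexStructure_sq φ ω (fun x y => by simpa using h.symm x y) ?_ ?_ ?_
    · simpa [hneg] using h.orthogonal 2 2 (by norm_num) _ hω _ hω
    · simpa [hneg] using h.orthogonal 0 0 (by norm_num) _ hc0 _ hc0
    · intro h0
      have := h.pos 2 ω hω hω0
      simp [hneg, h0] at this

lemma ksPiece_isInternal (ω : ℂ ⊗[ℚ] V)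
    (hJ : complexStructure φ ω * complexStructure φ ω = -1) :
    DirectSum.IsInternal (ksPiece φ ω) := by
  set J := complexStructure φ ω with hJdef
  have m1 : ∀ x, x ∈ ksPiece φ ω 1 ↔ J * x = Complex.I • x := fun x => by
    simp [ksPiece, hJdef]
  have m0 : ∀ x, x ∈ ksPiece φ ω 0 ↔ J * x = (-Complex.I) • x := fun x => by
    simp [ksPiece, hJdef]
  have mb : ∀ p : ℤ, p ≠ 1 → p ≠ 0 → ksPiece φ ω p = ⊥ := fun p h1 h0 => by
    simp [ksPiece, h1, h0]
  have hdis : Disjoint (ksPiece φ ω 1) (ksPiece φ ω 0) := by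
    rw [Submodule.disjoint_def]
    intro x h1 h0
    rw [m1] at h1
    rw [m0, h1] at h0
    have h2 : (2 * Complex.I) • x = 0 := by
      rw [two_mul, add_smul]
      nth_rewrite 1 [h0]
      rw [← add_smul, neg_add_cancel, zero_smul]
    exact (smul_eq_zero.mp h2).resolve_left (by simp)
  rw [DirectSum.isInternal_submodule_iff_iSupIndep_and_iSup_eq_top]
  constructor
  · rw [iSupIndep_def]
    intro p
    by_cases hp1 : p = 1
    · subst hp1
      refine hdis.mono_right (iSup₂_le fun j hj => ?_)
      by_cases hj0 : j = 0
      · rw [hj0]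
      · rw [mb j hj hj0]; exact bot_le
    · by_cases hp0 : p = 0
      · subst hp0
        refine hdis.symm.mono_right (iSup₂_le fun j hj => ?_)
        by_cases hj1 : j = 1
        · rw [hj1]
        · rw [mb j hj1 hj]; exact bot_le
      · rw [mb p hp1 hp0]; exact disjoint_bot_left
  · rw [eq_top_iff]
    intro x _
    have hJJ : ∀ y, J * (J * y) = -y := fun y => by rw [← mul_assoc, hJ, neg_one_mul]
    have hx : x = (2 : ℂ)⁻¹ • (x - Complex.I • (J * x)) +
        (2 : ℂ)⁻¹ • (x + Complex.I • (J * x)) := by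
      rw [← smul_add, sub_add_add_cancel, ← two_smul ℂ x, smul_smul]
      simp
    rw [hx]
    refine Submodule.add_mem _ (Submodule.smul_mem _ _ (le_iSup (ksPiece φ ω) 1 ?_))
      (Submodule.smul_mem _ _ (le_iSup (ksPiece φ ω) 0 ?_))
    · rw [m1, mul_sub, mul_smul_comm, hJJ, smul_sub, smul_smul, Complex.I_mul_I]
      simp [sub_eq_add_neg, add_comm]
    · rw [m0, mul_add, mul_smul_comm, hJJ, smul_add, smul_smul, neg_mul, Complex.I_mul_I]
      simp [add_comm]

lemma ksPiece_conj (ω : ℂ ⊗[ℚ] V) (p : ℤ) (x : ℂ ⊗[ℚ] ClEven φ) (hx : x ∈ ksPiece φ ω p) :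
    conjC _ x ∈ ksPiece φ ω (1 - p) := by
  have key : ∀ c : ℂ, complexStructure φ ω * x = c • x →
      complexStructure φ ω * conjC _ x = (starRingEnd ℂ c) • conjC _ x := fun c h => by
    rw [← conjC_smul, ← h, conjC_mul, conjC_complexStructure]
  by_cases hp1 : p = 1
  · subst hp1
    simp only [ksPiece, if_true, Module.End.mem_eigenspace_iff, LinearMap.mulLeft_apply] at hx
    simpa [ksPiece, Module.End.mem_eigenspace_iff] using key _ hx
  · by_cases hp0 : p = 0
    · subst hp0
      simp only [ksPiece, zero_ne_one, if_false, if_true, Module.End.mem_eigenspace_iff,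
        LinearMap.mulLeft_apply] at hx
      simpa [ksPiece, Module.End.mem_eigenspace_iff] using key _ hx
    · have : x = 0 := by simpa [ksPiece, hp1, hp0] using hx
      simp [this]

/-- The Kuga-Satake Hodge structure of weight `1` on `C⁺(V)` attached to a Hodge structure of
weight `2` on `V`, polarized (up to sign) by `φ`, and to a generator `ω` of `V^{2,0}`. -/
def kugaSatake (H : HodgeStructure V 2)
    (hφ : H.IsPolarization φ ∨ H.IsPolarization (-φ))
    (ω : ℂ ⊗[ℚ] V) (hω : ω ∈ H.piece 2) (hω0 : ω ≠ 0) : HodgeStructure (ClEven φ) 1 where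
  piece := ksPiece φ ω
  isInternal := ksPiece_isInternal φ ω
    (complexStructure_sq_of_polarization φ H hφ ω hω hω0)
  conj_mem := ksPiece_conj φ ω

end KS

end KugaSatake

end

open scoped TensorProduct
open Module

noncomputable section

namespace KugaSatake

/-! ### Vectors depending on a point through a ring of rational functions -/

section VectorValued

variable {T : Type*} {X Y Z : Type*} [AddCommGroup X] [Module ℚ X] [AddCommGroup Y] [Module ℚ Y]
  [AddCommGroup Z] [Module ℚ Z]

/-! Write `z = a + bi`. The element `a + bJ` acts on the `±i`-eigenspaces of `J` by `z` and its
conjugate, so `σ(a + bJ) = h(z)` on `C⁺(V)`. Conjugation by it multiplies `ω` by `z / conj z`,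
multiplies `conj ω` by the inverse and fixes `V^{1,1}`. So `ρ(a + bJ)` is `h(z/|z|)` on `V`; this is
`exists_sigma_eq_deligneHom`.

For `⊆` it remains to see that `σ(ρ⁻¹(Hdg V))` is algebraic over `ℚ`
(`isAlgebraicOverQ_map_sigma_comap_rho`). If `A = σ(g)`, then `g = A(1)` and `g⁻¹ = A⁻¹(1)`, so `g v
g⁻¹` is a regular function of `A`, and all the conditions are rational equations in `A`.

For `⊇`, let `M` be the Mumford-Tate group of `C⁺(V)`. It contains all homotheties, because `h(r) =
r` for real `r` and `ℝ` is Zariski dense in `ℂ` (`homothety_mem_mumfordTate`); hence homogeneous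
polynomials define it. The main point is that the rotations which lift to `M` form an algebraic
group over `ℚ` (`isAlgebraicOverQ_inf_map_rho`). Instead of a general theorem on images of algebraic
groups, an explicit inverse of `ρ` up to scalars is used. For `x` even and `e_I` the products of
vectors of an orthogonal basis, `∑_I ρ(g)(e_I) x e_I⁻¹ = g ∑_I e_I (g⁻¹ x) e_I⁻¹`, and the last sum
is a scalar. This is `spinLift`: it is polynomial in `ρ(g)`, and for a suitable `x` it is a nonzero
multiple of `g`. Homogeneous equations for `g` thus become equations for `ρ(g)`. That every complex
rotation lifts at all is Cartan-Dieudonné. The group so obtained contains `h(S¹)`, hence `Hdg(V)`;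
and membership of `σ(g)` in `M` depends only on `ρ(g)` (`mem_of_rho_eq`). -/

lemma dual_baseChange_tmul (ℓ : Dual ℚ X) (z : ℂ) (x : X) :
    Dual.baseChange ℂ ℓ (z ⊗ₜ x) = (ℓ x : ℂ) * z := by
  simp [Dual.baseChange, Algebra.smul_def]

lemma dual_baseChange_comp (ℓ : Dual ℚ Y) (f : X →ₗ[ℚ] Y) (x : ℂ ⊗[ℚ] X) :
    Dual.baseChange ℂ ℓ (f.baseChange ℂ x) = Dual.baseChange ℂ (ℓ ∘ₗ f) x := by
  induction x using TensorProduct.induction_on with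
  | zero => simp
  | tmul a w => simp
  | add x y hx hy => simp only [map_add, hx, hy]

lemma sum_coord_smul [FiniteDimensional ℚ X] (x : ℂ ⊗[ℚ] X) :
    x = ∑ i, Dual.baseChange ℂ ((finBasis ℚ X).coord i) x • ((1 : ℂ) ⊗ₜ[ℚ] finBasis ℚ X i) := by
  induction x using TensorProduct.induction_on with
  | zero => simp
  | tmul a w =>
    conv_lhs => rw [← (finBasis ℚ X).sum_repr w]
    simp only [TensorProduct.tmul_sum, dual_baseChange_tmul, TensorProduct.smul_tmul', smul_eq_mul,
      Basis.coord_apply]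
    refine Finset.sum_congr rfl fun i _ => ?_
    rw [TensorProduct.tmul_smul, TensorProduct.smul_tmul', Algebra.smul_def]
    simp
  | add x y hx hy =>
    simp only [map_add, add_smul, Finset.sum_add_distrib]
    rw [← hx, ← hy]

lemma eq_zero_of_dual_baseChange [FiniteDimensional ℚ X] (x : ℂ ⊗[ℚ] X)
    (h : ∀ ℓ : Dual ℚ X, Dual.baseChange ℂ ℓ x = 0) : x = 0 := by
  rw [sum_coord_smul x]
  simp [h]

/-- A map to `ℂ ⊗ X` all of whose rational coordinates lie in the algebra `R` of functions. -/
def HasCoordsIn (R : Subalgebra ℚ (T → ℂ)) (F : T → ℂ ⊗[ℚ] X) : Prop :=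
  ∀ ℓ : Dual ℚ X, (fun t => Dual.baseChange ℂ ℓ (F t)) ∈ R

namespace HasCoordsIn

variable {R : Subalgebra ℚ (T → ℂ)}

lemma mono {R' : Subalgebra ℚ (T → ℂ)} (h : R ≤ R') {F : T → ℂ ⊗[ℚ] X} (hF : HasCoordsIn R F) :
    HasCoordsIn R' F := fun ℓ => h (hF ℓ)

lemma const (x : X) : HasCoordsIn R fun _ => (1 : ℂ) ⊗ₜ[ℚ] x := fun ℓ => by
  have : (fun _ : T => Dual.baseChange ℂ ℓ ((1 : ℂ) ⊗ₜ[ℚ] x)) = algebraMap ℚ (T → ℂ) (ℓ x) := by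
    ext t
    simp
  rw [this]
  exact R.algebraMap_mem _

lemma add {F G : T → ℂ ⊗[ℚ] X} (hF : HasCoordsIn R F) (hG : HasCoordsIn R G) :
    HasCoordsIn R fun t => F t + G t := fun ℓ => by
  simp only [map_add]
  exact R.add_mem (hF ℓ) (hG ℓ)

lemma sub {F G : T → ℂ ⊗[ℚ] X} (hF : HasCoordsIn R F) (hG : HasCoordsIn R G) :
    HasCoordsIn R fun t => F t - G t := fun ℓ => by
  simp only [map_sub]
  exact R.sub_mem (hF ℓ) (hG ℓ)

lemma smul {f : T → ℂ} {F : T → ℂ ⊗[ℚ] X} (hf : f ∈ R) (hF : HasCoordsIn R F) :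
    HasCoordsIn R fun t => f t • F t := fun ℓ => by
  simp only [map_smul, smul_eq_mul]
  exact R.mul_mem hf (hF ℓ)

lemma rat_smul (q : ℚ) {F : T → ℂ ⊗[ℚ] X} (hF : HasCoordsIn R F) :
    HasCoordsIn R fun t => (q : ℂ) • F t :=
  smul (f := algebraMap ℚ (T → ℂ) q) (R.algebraMap_mem q) hF

lemma sum {ι : Type*} (s : Finset ι) {F : ι → T → ℂ ⊗[ℚ] X} (hF : ∀ i ∈ s, HasCoordsIn R (F i)) :
    HasCoordsIn R fun t => ∑ i ∈ s, F i t := fun ℓ => by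
  simp only [map_sum]
  have := R.sum_mem fun i hi => hF i hi ℓ
  convert! this using 1
  ext t
  simp

lemma baseChange (f : X →ₗ[ℚ] Y) {F : T → ℂ ⊗[ℚ] X} (hF : HasCoordsIn R F) :
    HasCoordsIn R fun t => f.baseChange ℂ (F t) := fun ℓ => by
  simp only [dual_baseChange_comp]
  exact hF _

/-- Expanding `F t` in a rational basis gives finitely many products of a coordinate of `F` with a
value of `A` on a rational vector. -/
lemma apply [FiniteDimensional ℚ X] {A : T → Module.End ℂ (ℂ ⊗[ℚ] X)} {F : T → ℂ ⊗[ℚ] X}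
    (hA : ∀ x : X, HasCoordsIn R fun t => A t (1 ⊗ₜ x)) (hF : HasCoordsIn R F) :
    HasCoordsIn R fun t => A t (F t) := by
  have h : (fun t => A t (F t)) = fun t => ∑ i,
      Dual.baseChange ℂ ((finBasis ℚ X).coord i) (F t) • A t ((1 : ℂ) ⊗ₜ[ℚ] finBasis ℚ X i) := by
    ext t
    conv_lhs => rw [sum_coord_smul (F t)]
    simp
  rw [h]
  exact sum _ fun i _ => smul (hF _) (hA _)

lemma mul {A : Type*} [Ring A] [Algebra ℚ A] [FiniteDimensional ℚ A] {F G : T → ℂ ⊗[ℚ] A}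
    (hF : HasCoordsIn R F) (hG : HasCoordsIn R G) : HasCoordsIn R fun t => F t * G t := by
  refine apply (A := fun t => LinearMap.mulLeft ℂ (F t)) (fun a => ?_) hG
  refine apply (A := fun t => LinearMap.mulRight ℂ (1 ⊗ₜ[ℚ] a)) (fun b => ?_) hF
  simpa using const (b * a)

lemma bilin {φ : LinearMap.BilinForm ℚ X} [FiniteDimensional ℚ X] {F G : T → ℂ ⊗[ℚ] X}
    (hF : HasCoordsIn R F) (hG : HasCoordsIn R G) :
    (fun t => φ.baseChange ℂ (F t) (G t)) ∈ R := by
  have h : (fun t => φ.baseChange ℂ (F t) (G t)) = ∑ i, (fun t =>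
      Dual.baseChange ℂ ((finBasis ℚ X).coord i) (F t)) *
        fun t => Dual.baseChange ℂ (φ (finBasis ℚ X i)) (G t) := by
    have key : ∀ (v : X) (y : ℂ ⊗[ℚ] X), φ.baseChange ℂ (1 ⊗ₜ v) y = Dual.baseChange ℂ (φ v) y := by
      intro v y
      induction y using TensorProduct.induction_on with
      | zero => simp
      | tmul a w => simp [Rat.smul_def]
      | add x y hx hy => simp only [map_add, hx, hy]
    ext t
    conv_lhs => rw [sum_coord_smul (F t)]
    simp [key]
  rw [h]
  exact R.sum_mem fun i _ => R.mul_mem (hF _) (hG _)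

end HasCoordsIn

end VectorValued

/-! ### Regular functions on `GL(W)` defined over `ℚ` -/

section Regular

variable (W : Type*) [AddCommGroup W] [Module ℚ W]

/-- The functions on `GL(W)(ℂ)` that are rational polynomials in the matrix coefficients. -/
def polyFun : Subalgebra ℚ (GLC W → ℂ) :=
  (MvPolynomial.aeval fun c g => matrixCoeff g c :
    MvPolynomial (W × Dual ℚ W) ℚ →ₐ[ℚ] (GLC W → ℂ)).range

variable {W}

lemma aeval_matrixCoeff_apply (P : MvPolynomial (W × Dual ℚ W) ℚ) (g : GLC W) :
    MvPolynomial.aeval (fun c (g : GLC W) => matrixCoeff g c) P g =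
      MvPolynomial.aeval (matrixCoeff g) P := by
  have := MvPolynomial.comp_aeval_apply (fun c (g : GLC W) => matrixCoeff g c)
    (Pi.evalAlgHom ℚ (fun _ : GLC W => ℂ) g) P
  exact this

lemma mem_polyFun {f : GLC W → ℂ} :
    f ∈ polyFun W ↔ ∃ P : MvPolynomial (W × Dual ℚ W) ℚ,
      ∀ g, f g = MvPolynomial.aeval (matrixCoeff g) P := by
  constructor
  · rintro ⟨P, rfl⟩
    exact ⟨P, fun g => aeval_matrixCoeff_apply P g⟩
  · rintro ⟨P, hP⟩
    refine ⟨P, funext fun g => ?_⟩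
    rw [hP]
    exact aeval_matrixCoeff_apply P g

lemma aeval_mem_of_forall_mem {T σ : Type*} (R : Subalgebra ℚ (T → ℂ)) (f : σ → T → ℂ)
    (hf : ∀ i, f i ∈ R) (P : MvPolynomial σ ℚ) :
    (fun t => MvPolynomial.aeval (fun i => f i t) P) ∈ R := by
  have h : (fun t => MvPolynomial.aeval (fun i => f i t) P) = MvPolynomial.aeval f P := by
    ext t
    exact (MvPolynomial.comp_aeval_apply f (Pi.evalAlgHom ℚ (fun _ : T => ℂ) t) P).symm
  rw [h]
  have : MvPolynomial.aeval f P = R.val (MvPolynomial.aeval (fun i => (⟨f i, hf i⟩ : R)) P) := by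
    rw [MvPolynomial.comp_aeval_apply]; rfl
  rw [this]
  exact Subtype.property _

lemma hasCoordsIn_polyFun_apply (w : W) :
    HasCoordsIn (polyFun W) fun g : GLC W => (g : Module.End ℂ (ℂ ⊗[ℚ] W)) (1 ⊗ₜ w) := fun ℓ =>
  mem_polyFun.mpr ⟨MvPolynomial.X (w, ℓ), fun g => by simp [matrixCoeff]⟩

/-- The determinant on `GL(W)(ℂ)`. -/
def detFun (g : GLC W) : ℂ := LinearMap.det (g : Module.End ℂ (ℂ ⊗[ℚ] W))

lemma detFun_ne_zero (g : GLC W) : detFun g ≠ 0 :=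
  ((Units.isUnit g).map (LinearMap.det : Module.End ℂ (ℂ ⊗[ℚ] W) →* ℂ)).ne_zero

variable [FiniteDimensional ℚ W]

/-- The basis of `ℂ ⊗ W` given by a basis of `W`. -/
def basisC (W : Type*) [AddCommGroup W] [Module ℚ W] [FiniteDimensional ℚ W] :
    Basis (Fin (finrank ℚ W)) ℂ (ℂ ⊗[ℚ] W) :=
  Algebra.TensorProduct.basis ℂ (finBasis ℚ W)

lemma basisC_repr (x : ℂ ⊗[ℚ] W) (i) :
    (basisC W).repr x i = Dual.baseChange ℂ ((finBasis ℚ W).coord i) x := by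
  induction x using TensorProduct.induction_on with
  | zero => simp
  | tmul a w =>
    rw [dual_baseChange_tmul, basisC, Algebra.TensorProduct.basis_repr_tmul]
    simp [mul_comm]
  | add x y hx hy => simp only [map_add, Finsupp.add_apply, hx, hy]

lemma det_mem_of_apply_mem {T : Type*} {R : Subalgebra ℚ (T → ℂ)} {n : ℕ}
    (M : T → Matrix (Fin n) (Fin n) ℂ) (hM : ∀ i j, (fun t => M t i j) ∈ R) :
    (fun t => (M t).det) ∈ R := by
  have h : (fun t => (M t).det) = ∑ σ : Equiv.Perm (Fin n),
      (Equiv.Perm.sign σ : ℤ) • ∏ i, fun t => M t (σ i) i := by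
    ext t
    simp [Matrix.det_apply, Units.smul_def]
  rw [h]
  exact R.sum_mem fun σ _ => R.zsmul_mem (R.prod_mem fun i _ => hM _ _) _

lemma toMatrix_mem_polyFun (i j) :
    (fun g : GLC W => LinearMap.toMatrix (basisC W) (basisC W) (g : Module.End ℂ (ℂ ⊗[ℚ] W)) i j) ∈
      polyFun W := by
  simp only [LinearMap.toMatrix_apply, basisC_repr]
  rw [basisC]
  simp only [Algebra.TensorProduct.basis_apply]
  exact hasCoordsIn_polyFun_apply _ _

lemma detFun_mem_polyFun : (detFun : GLC W → ℂ) ∈ polyFun W := by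
  have := det_mem_of_apply_mem _ (toMatrix_mem_polyFun (W := W))
  simpa only [LinearMap.det_toMatrix] using! this

variable (W) in
/-- The functions on `GL(W)(ℂ)` that become rational polynomials in the matrix coefficients after
multiplication by a power of the determinant. -/
def regFun : Subalgebra ℚ (GLC W → ℂ) where
  carrier := {f | ∃ k : ℕ, detFun ^ k * f ∈ polyFun W}
  mul_mem' := by
    rintro f g ⟨k, hk⟩ ⟨l, hl⟩
    refine ⟨k + l, ?_⟩
    have := (polyFun W).mul_mem hk hl
    rwa [mul_mul_mul_comm, ← pow_add] at this
  add_mem' := by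
    rintro f g ⟨k, hk⟩ ⟨l, hl⟩
    refine ⟨k + l, ?_⟩
    have h1 := (polyFun W).mul_mem ((polyFun W).pow_mem detFun_mem_polyFun l) hk
    have h2 := (polyFun W).mul_mem ((polyFun W).pow_mem detFun_mem_polyFun k) hl
    have := (polyFun W).add_mem h1 h2
    convert! this using 1
    ring
  algebraMap_mem' r := ⟨0, by simp⟩

lemma polyFun_le_regFun : polyFun W ≤ regFun W := fun f hf => ⟨0, by simpa using hf⟩

/-- The determinant has no zero on `GL(W)(ℂ)`, so clearing denominators leaves the zero locus
unchanged. This makes equations that involve `g⁻¹` admissible. -/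
lemma isAlgebraicOverQ_of_regFun (G : Subgroup (GLC W)) (F : Set (GLC W → ℂ)) (hF : F ⊆ regFun W)
    (hG : ∀ g, g ∈ G ↔ ∀ f ∈ F, f g = 0) : IsAlgebraicOverQ G := by
  refine ⟨{P | ∃ f ∈ F, ∃ k : ℕ, ∀ g : GLC W,
    detFun g ^ k * f g = MvPolynomial.aeval (matrixCoeff g) P}, fun g => ?_⟩
  rw [hG]
  constructor
  · rintro h P ⟨f, hf, k, hP⟩
    rw [← hP, h f hf, mul_zero]
  · intro h f hf
    obtain ⟨k, hk⟩ := hF hf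
    obtain ⟨P, hP⟩ := mem_polyFun.mp hk
    have h0 := h P ⟨f, hf, k, hP⟩
    rw [← hP] at h0
    exact (mul_eq_zero.mp h0).resolve_left (pow_ne_zero _ (detFun_ne_zero g))

/-- Cramer's rule: the inverse is the adjugate, with polynomial entries, divided by the determinant.
-/
lemma hasCoordsIn_regFun_inv_apply (w : W) :
    HasCoordsIn (regFun W) fun g : GLC W =>
      ((g⁻¹ : GLC W) : Module.End ℂ (ℂ ⊗[ℚ] W)) (1 ⊗ₜ w) := by
  have hdetinv : (fun g : GLC W => (detFun g)⁻¹) ∈ regFun W := by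
    refine ⟨1, ?_⟩
    have : detFun ^ 1 * (fun g : GLC W => (detFun g)⁻¹) = 1 := by
      ext g
      simp [detFun_ne_zero g]
    rw [this]
    exact (polyFun W).one_mem
  have hadj : ∀ i j, (fun g : GLC W => (LinearMap.toMatrix (basisC W) (basisC W)
      (g : Module.End ℂ (ℂ ⊗[ℚ] W))).adjugate i j) ∈ polyFun W := by
    intro i j
    simp only [Matrix.adjugate_apply]
    refine det_mem_of_apply_mem _ fun k l => ?_
    by_cases hk : k = j
    · subst hk
      simp only [Matrix.updateRow_self]
      by_cases hl : l = i
      · subst hl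
        simp only [Pi.single_eq_same]
        exact (polyFun W).one_mem
      · simp only [Pi.single_apply, hl, if_false]
        exact (polyFun W).zero_mem
    · simpa only [Matrix.updateRow_ne hk] using toMatrix_mem_polyFun k l
  have hentry : ∀ i j, (fun g : GLC W => (basisC W).repr
      (((g⁻¹ : GLC W) : Module.End ℂ (ℂ ⊗[ℚ] W)) (basisC W j)) i) ∈ regFun W := by
    intro i j
    have : (fun g : GLC W => (basisC W).repr
        (((g⁻¹ : GLC W) : Module.End ℂ (ℂ ⊗[ℚ] W)) (basisC W j)) i) =
        (fun g : GLC W => (detFun g)⁻¹) * fun g : GLC W => (LinearMap.toMatrix (basisC W) (basisC W)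
          (g : Module.End ℂ (ℂ ⊗[ℚ] W))).adjugate i j := by
      ext g
      set M := LinearMap.toMatrix (basisC W) (basisC W) (g : Module.End ℂ (ℂ ⊗[ℚ] W)) with hM
      have hinv : LinearMap.toMatrix (basisC W) (basisC W)
          ((g⁻¹ : GLC W) : Module.End ℂ (ℂ ⊗[ℚ] W)) = M⁻¹ := by
        symm
        apply Matrix.inv_eq_right_inv
        rw [hM, ← LinearMap.toMatrix_mul, Units.mul_inv, LinearMap.toMatrix_one]
      rw [← LinearMap.toMatrix_apply, hinv, Matrix.inv_def, Pi.mul_apply, Matrix.smul_apply,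
        Ring.inverse_eq_inv', hM, LinearMap.det_toMatrix]
      rfl
    rw [this]
    exact (regFun W).mul_mem hdetinv (polyFun_le_regFun (hadj i j))
  intro ℓ
  have h : (fun g : GLC W => Dual.baseChange ℂ ℓ
      (((g⁻¹ : GLC W) : Module.End ℂ (ℂ ⊗[ℚ] W)) (1 ⊗ₜ w))) =
      ∑ i, ∑ j, algebraMap ℚ (GLC W → ℂ) ((finBasis ℚ W).repr w j * ℓ (finBasis ℚ W i)) *
        fun g : GLC W => (basisC W).repr
          (((g⁻¹ : GLC W) : Module.End ℂ (ℂ ⊗[ℚ] W)) (basisC W j)) i := by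
    ext g
    have hw : (1 : ℂ) ⊗ₜ[ℚ] w = ∑ j, (((finBasis ℚ W).repr w j : ℚ) : ℂ) • basisC W j := by
      rw [sum_coord_smul (1 ⊗ₜ[ℚ] w)]
      simp [basisC]
    rw [sum_coord_smul (((g⁻¹ : GLC W) : Module.End ℂ (ℂ ⊗[ℚ] W)) (1 ⊗ₜ w)), hw]
    simp only [map_sum, map_smul, Finset.sum_apply, Pi.mul_apply, Pi.algebraMap_apply, basisC_repr,
      smul_eq_mul, dual_baseChange_tmul, Finset.sum_mul, mul_one, eq_ratCast, Rat.cast_mul]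
    exact Finset.sum_congr rfl fun i _ => Finset.sum_congr rfl fun j _ => by ring
  rw [h]
  exact (regFun W).sum_mem fun i _ => (regFun W).sum_mem fun j _ =>
    (regFun W).mul_mem ((regFun W).algebraMap_mem _) (hentry i j)

/-- The polynomials vanishing on at least one of the groups being intersected, taken together,
define the intersection. -/
lemma isAlgebraicOverQ_algebraicHull {W : Type*} [AddCommGroup W] [Module ℚ W] (T : Set (GLC W)) :
    IsAlgebraicOverQ (algebraicHull T) := by
  refine ⟨{P | ∃ G : Subgroup (GLC W), (IsAlgebraicOverQ G ∧ T ⊆ (G : Set (GLC W))) ∧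
    ∀ g ∈ G, MvPolynomial.aeval (matrixCoeff g) P = 0}, fun g => ?_⟩
  rw [algebraicHull, Subgroup.mem_sInf]
  constructor
  · rintro h P ⟨G, hG, hP⟩
    exact hP g (h G hG)
  · rintro h G ⟨⟨S, hS⟩, hT⟩
    exact (hS g).mpr fun P hP => h P ⟨G, ⟨⟨S, hS⟩, hT⟩, fun g hg => (hS g).mp hg P hP⟩

lemma subset_algebraicHull {W : Type*} [AddCommGroup W] [Module ℚ W] (T : Set (GLC W)) :
    T ⊆ (algebraicHull T : Set (GLC W)) := fun _ ht =>
  Subgroup.mem_sInf.mpr fun _ hG => hG.2 ht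

lemma algebraicHull_le {W : Type*} [AddCommGroup W] [Module ℚ W] {T : Set (GLC W)}
    {G : Subgroup (GLC W)} (hG : IsAlgebraicOverQ G) (hT : T ⊆ (G : Set (GLC W))) :
    algebraicHull T ≤ G :=
  sInf_le ⟨hG, hT⟩

end Regular

/-! ### Words in anticommuting elements -/

section Words

variable {K R ι : Type*} [CommRing K] [Ring R] [Algebra K R]

/-- The operator `x ↦ ∏ⱼ (qⱼ + aⱼ · bⱼ) x`, over the list of indices `j`. -/
def twistedSum (q : ι → K) (a b : ι → R) : List ι → R →ₗ[K] R
  | [] => LinearMap.id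
  | j :: l => (q j • LinearMap.id + LinearMap.mulLeft K (a j) ∘ₗ LinearMap.mulRight K (b j)) ∘ₗ
      twistedSum q a b l

lemma twistedSum_cons (q : ι → K) (a b : ι → R) (j : ι) (l : List ι) (x : R) :
    twistedSum q a b (j :: l) x =
      q j • twistedSum q a b l x + a j * (twistedSum q a b l x * b j) := rfl

/-- Used with `a j = ρ(g)(e_j)` and `b j = e_j`: each factor lets `g` pass to the left and becomes
untwisted. -/
lemma twistedSum_mul (q : ι → K) (a b : ι → R) (g : R) (h : ∀ j, a j * g = g * b j) (l : List ι)
    (y : R) : twistedSum q a b l (g * y) = g * twistedSum q b b l y := by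
  induction l with
  | nil => rfl
  | cons j l ih =>
    rw [twistedSum_cons, twistedSum_cons, ih, mul_add, mul_smul_comm, mul_assoc g,
      ← mul_assoc (a j), h, mul_assoc]

variable (e : ι → R)

/-- The product of the elements of `R` indexed by the list. -/
def word (l : List ι) : R := (l.map e).prod

@[simp] lemma word_nil : word e [] = 1 := rfl

@[simp] lemma word_cons (i : ι) (l : List ι) : word e (i :: l) = e i * word e l := by
  simp [word]

variable (K) in
/-- The span of the words of length of given parity without repetitions. -/
def wordSpan (p : ZMod 2) : Submodule K R :=
  Submodule.span K (word e '' {l | l.Nodup ∧ (l.length : ZMod 2) = p})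

lemma wordSpan_finite [Finite ι] (p : ZMod 2) : (wordSpan K e p).FG := by
  refine Submodule.fg_span (Set.Finite.image _ ?_)
  have : Set.Finite {l : List ι | l.Nodup} := by
    classical
    have := Fintype.ofFinite ι
    exact Set.finite_coe_iff.mp (inferInstanceAs (Finite {l : List ι // l.Nodup}))
  exact this.subset fun l hl => hl.1

variable {e} {q : ι → K}
  (hq : ∀ i, e i * e i = algebraMap K R (q i))
  (he : ∀ i j, i ≠ j → e i * e j = -(e j * e i))

include he in
lemma mul_word_of_notMem (a : ι) (l : List ι) (h : a ∉ l) :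
    e a * word e l = (-1 : K) ^ l.length • (word e l * e a) := by
  induction l with
  | nil => simp
  | cons b t ih =>
    rw [List.mem_cons, not_or] at h
    rw [word_cons, ← mul_assoc, he a b h.1, neg_mul, mul_assoc, ih h.2, List.length_cons, pow_succ]
    simp [mul_assoc]

include he in
lemma mul_word_of_mem (a : ι) (l : List ι) (hl : l.Nodup) (h : a ∈ l) :
    e a * word e l = -((-1 : K) ^ l.length • (word e l * e a)) := by
  induction l with
  | nil => simp at h
  | cons b t ih =>
    rw [List.nodup_cons] at hl
    by_cases hab : a = b
    · subst hab
      have := mul_word_of_notMem (K := K) he a t hl.1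
      rw [word_cons, List.length_cons, pow_succ, mul_neg_one, neg_smul, neg_neg, mul_assoc,
        ← mul_smul_comm, ← this]
    · rw [word_cons, ← mul_assoc, he a b hab, neg_mul, mul_assoc,
        ih hl.2 (by simpa [hab] using h), List.length_cons, pow_succ]
      simp [mul_assoc]

include hq he in
lemma exists_mul_word_eq_smul_erase [DecidableEq ι] (a : ι) (l : List ι) (h : a ∈ l) :
    ∃ c : K, e a * word e l = c • word e (l.erase a) := by
  induction l with
  | nil => simp at h
  | cons b t ih =>
    by_cases hab : b = a
    · subst hab
      exact ⟨q b, by rw [word_cons, ← mul_assoc, hq, List.erase_cons_head, Algebra.smul_def]⟩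
    · obtain ⟨c, hc⟩ := ih (by simpa [Ne.symm hab] using h)
      refine ⟨-c, ?_⟩
      rw [word_cons, ← mul_assoc, he a b (Ne.symm hab), neg_mul, mul_assoc, hc,
        List.erase_cons_tail (by simpa using hab), word_cons]
      simp

include hq he in
-- The letter `a` either cancels against its occurrence in the word or lengthens the word by one;
-- the parity changes in both cases.
lemma mul_mem_wordSpan (a : ι) (p : ZMod 2) {x : R} (hx : x ∈ wordSpan K e p) :
    e a * x ∈ wordSpan K e (p + 1) := by
  classical
  induction hx using Submodule.span_induction with
  | mem x hx =>
    obtain ⟨l, ⟨hl, hlp⟩, rfl⟩ := hx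
    by_cases ha : a ∈ l
    · obtain ⟨c, hc⟩ := exists_mul_word_eq_smul_erase hq he a l ha
      rw [hc]
      refine Submodule.smul_mem _ _ (Submodule.subset_span ⟨_, ⟨hl.erase a, ?_⟩, rfl⟩)
      -- Subtracting `1` and adding `1` agree in `ZMod 2`.
      rw [List.length_erase_of_mem ha, Nat.cast_sub (List.length_pos_of_mem ha), hlp, Nat.cast_one,
        sub_eq_add_neg]
      rfl
    · rw [← word_cons]
      exact Submodule.subset_span ⟨_, ⟨List.nodup_cons.mpr ⟨ha, hl⟩, by simp [hlp]⟩, rfl⟩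
  | zero => simp
  | add x y _ _ hx hy => rw [mul_add]; exact Submodule.add_mem _ hx hy
  | smul c x _ hx => rw [mul_smul_comm]; exact Submodule.smul_mem _ _ hx

include hq he in
lemma mul_mem_wordSpan_of_mem_span {v : R} (hv : v ∈ Submodule.span K (Set.range e)) (p : ZMod 2)
    {x : R} (hx : x ∈ wordSpan K e p) : v * x ∈ wordSpan K e (p + 1) := by
  induction hv using Submodule.span_induction with
  | mem v hv =>
    obtain ⟨a, rfl⟩ := hv
    exact mul_mem_wordSpan hq he a p hx
  | zero => simp
  | add x y _ _ hx hy => rw [add_mul]; exact Submodule.add_mem _ hx hy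
  | smul c x _ hx => rw [smul_mul_assoc]; exact Submodule.smul_mem _ _ hx

lemma one_mem_wordSpan : (1 : R) ∈ wordSpan K e 0 :=
  Submodule.subset_span ⟨[], ⟨List.nodup_nil, by simp⟩, rfl⟩

include hq in
lemma twistedSum_one (l : List ι) :
    twistedSum q e e l 1 = algebraMap K R (l.map fun j => 2 * q j).prod := by
  induction l with
  | nil => simp [twistedSum]
  | cons j l ih =>
    rw [twistedSum_cons, ih, Algebra.commutes, ← mul_assoc, hq, ← map_mul,
      Algebra.smul_def, ← map_mul, ← map_add, List.map_cons, List.prod_cons]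
    congr 1
    ring

include hq he in
-- Moving `e j` past a word of even length costs an even number of signs if `j` is absent, and one
-- sign fewer if `j` occurs once. So the factor `q j + e j · e j` acts on the word as `2 q j` or as
-- `0`.
lemma mul_word_mul (j : ι) (w : List ι) (hw : w.Nodup) (hev : Even w.length) :
    (j ∈ w → e j * (word e w * e j) = -(q j • word e w)) ∧
      (j ∉ w → e j * (word e w * e j) = q j • word e w) := by
  constructor <;> intro h
  · rw [← mul_assoc, mul_word_of_mem (K := K) he j w hw h, hev.neg_one_pow, one_smul, neg_mul,
      mul_assoc, hq, Algebra.smul_def, Algebra.commutes]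
  · rw [← mul_assoc, mul_word_of_notMem (K := K) he j w h, hev.neg_one_pow, one_smul,
      mul_assoc, hq, Algebra.smul_def, Algebra.commutes]

include hq he in
lemma exists_twistedSum_word (w : List ι) (hw : w.Nodup) (hev : Even w.length) (l : List ι) :
    ∃ c : K, twistedSum q e e l (word e w) = c • word e w := by
  induction l with
  | nil => exact ⟨1, by simp [twistedSum]⟩
  | cons j l ih =>
    obtain ⟨c, hc⟩ := ih
    have h := mul_word_mul hq he j w hw hev
    rw [twistedSum_cons, hc, smul_mul_assoc, mul_smul_comm]
    by_cases hj : j ∈ w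
    · exact ⟨0, by rw [h.1 hj, smul_neg, smul_comm, add_neg_cancel, zero_smul]⟩
    · exact ⟨q j * c + c * q j, by rw [h.2 hj, add_smul, mul_smul, mul_smul]⟩

include hq he in
-- Words are eigenvectors of all the factors, and the factor of a letter of `w` has eigenvalue `q a
-- - q a = 0`.
lemma twistedSum_word_eq_zero (w : List ι) (hw : w.Nodup) (hev : Even w.length) (l : List ι)
    (a : ι) (haw : a ∈ w) (hal : a ∈ l) : twistedSum q e e l (word e w) = 0 := by
  induction l with
  | nil => simp at hal
  | cons j l ih =>
    rw [twistedSum_cons]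
    rcases List.mem_cons.mp hal with rfl | hal
    · obtain ⟨c, hc⟩ := exists_twistedSum_word hq he w hw hev l
      rw [hc, smul_mul_assoc, mul_smul_comm, (mul_word_mul hq he a w hw hev).1 haw, smul_neg,
        smul_comm, add_neg_cancel]
    · rw [ih hal]
      simp

include hq he in
-- Every letter occurs in `l`, so each nonempty even word is killed and only the empty word, a
-- scalar, survives. Evenness matters: it fixes the signs in `mul_word_mul`.
lemma exists_twistedSum_eq_algebraMap (l : List ι) (hl : ∀ i, i ∈ l) {x : R}
    (hx : x ∈ wordSpan K e 0) : ∃ c : K, twistedSum q e e l x = algebraMap K R c := by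
  induction hx using Submodule.span_induction with
  | mem x hx =>
    obtain ⟨w, ⟨hw, hp⟩, rfl⟩ := hx
    cases w with
    | nil => exact ⟨_, twistedSum_one hq l⟩
    | cons a w =>
      refine ⟨0, ?_⟩
      rw [map_zero]
      exact twistedSum_word_eq_zero hq he _ hw (ZMod.natCast_eq_zero_iff_even.mp hp) l a (by simp)
        (hl a)
  | zero => exact ⟨0, by simp⟩
  | add x y _ _ hx hy =>
    obtain ⟨c, hc⟩ := hx
    obtain ⟨d, hd⟩ := hy
    exact ⟨c + d, by rw [map_add, map_add, hc, hd]⟩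
  | smul k x _ hx =>
    obtain ⟨c, hc⟩ := hx
    exact ⟨k * c, by rw [map_smul, hc, map_mul, Algebra.smul_def]⟩

end Words

/-! ### Orthogonal bases and the Clifford algebra -/

section CliffordBasis

variable {V : Type*} [AddCommGroup V] [Module ℚ V] {φ : LinearMap.BilinForm ℚ V}

lemma baseChange_comm (hs : ∀ x y, φ x y = φ y x) (x y : ℂ ⊗[ℚ] V) :
    φ.baseChange ℂ x y = φ.baseChange ℂ y x := by
  have h : LinearMap.IsSymm φ := ⟨fun x y => hs x y⟩
  exact (LinearMap.BilinForm.IsSymm.baseChange ℂ h).eq x y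

variable (φ) in
lemma iotaC_mul_self (v : ℂ ⊗[ℚ] V) :
    iotaC φ v * iotaC φ v = algebraMap ℂ _ (φ.baseChange ℂ v v) := by
  have h := iotaC_mul_add_swap φ v v
  rw [← two_smul ℂ, ← two_mul, map_mul, ← Algebra.smul_def] at h
  exact smul_right_injective _ (two_ne_zero (α := ℂ)) h

lemma iotaC_mul_eq_neg (hs : ∀ x y, φ x y = φ y x) {v w : ℂ ⊗[ℚ] V}
    (h : φ.baseChange ℂ v w = 0) : iotaC φ v * iotaC φ w = -(iotaC φ w * iotaC φ v) := by
  apply eq_neg_of_add_eq_zero_left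
  rw [iotaC_mul_add_swap, baseChange_comm hs w v, h, add_zero, map_zero]

variable {ι : Type*} (b : Basis ι ℚ V)

lemma iota_mem_span_basis (v : V) : CliffordAlgebra.ι φ.toQuadraticMap v ∈
    Submodule.span ℚ (Set.range fun i => CliffordAlgebra.ι φ.toQuadraticMap (b i)) := by
  have : v ∈ Submodule.span ℚ (Set.range b) := b.span_eq ▸ Submodule.mem_top
  have := Submodule.mem_map_of_mem (f := CliffordAlgebra.ι φ.toQuadraticMap) this
  rwa [Submodule.map_span, ← Set.range_comp] at this

lemma iota_basis_mul_self (i : ι) :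
    CliffordAlgebra.ι φ.toQuadraticMap (b i) * CliffordAlgebra.ι φ.toQuadraticMap (b i) =
      algebraMap ℚ _ (φ (b i) (b i)) :=
  CliffordAlgebra.ι_sq_scalar _ _

lemma iota_basis_mul_comm (hs : ∀ x y, φ x y = φ y x) (hb : ∀ i j, i ≠ j → φ (b i) (b j) = 0)
    (i j : ι) (hij : i ≠ j) :
    CliffordAlgebra.ι φ.toQuadraticMap (b i) * CliffordAlgebra.ι φ.toQuadraticMap (b j) =
      -(CliffordAlgebra.ι φ.toQuadraticMap (b j) * CliffordAlgebra.ι φ.toQuadraticMap (b i)) := by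
  apply eq_neg_of_add_eq_zero_left
  rw [CliffordAlgebra.ι_mul_ι_add_swap]
  simp [QuadraticMap.polar, hb i j hij, hs (b j) (b i)]

lemma mem_wordSpan_of_mem_even (hs : ∀ x y, φ x y = φ y x)
    (hb : ∀ i j, i ≠ j → φ (b i) (b j) = 0) (x : Cl φ)
    (hx : x ∈ CliffordAlgebra.even φ.toQuadraticMap) :
    x ∈ wordSpan ℚ (fun i => CliffordAlgebra.ι φ.toQuadraticMap (b i)) 0 := by
  have hx' : x ∈ CliffordAlgebra.evenOdd φ.toQuadraticMap 0 := hx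
  clear hx
  induction x, hx' using CliffordAlgebra.even_induction with
  | algebraMap r =>
    rw [Algebra.algebraMap_eq_smul_one]
    exact Submodule.smul_mem _ _ one_mem_wordSpan
  | add x y hx hy h1 h2 => exact Submodule.add_mem _ h1 h2
  | ι_mul_ι_mul m₁ m₂ x hx h =>
    rw [mul_assoc]
    have := mul_mem_wordSpan_of_mem_span (iota_basis_mul_self b) (iota_basis_mul_comm b hs hb)
      (iota_mem_span_basis b m₁) _ (mul_mem_wordSpan_of_mem_span (iota_basis_mul_self b)
      (iota_basis_mul_comm b hs hb) (iota_mem_span_basis b m₂) _ h)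
    exact this

/-- The finitely many words without repetition span, because left multiplication by a vector
preserves their span. -/
lemma cliffordAlgebra_finite [Finite ι] (hs : ∀ x y, φ x y = φ y x)
    (hb : ∀ i j, i ≠ j → φ (b i) (b j) = 0) : FiniteDimensional ℚ (Cl φ) := by
  have h : ∀ x : Cl φ, x ∈ ⨆ p, wordSpan ℚ (fun i => CliffordAlgebra.ι φ.toQuadraticMap (b i)) p := by
    intro x
    induction x using CliffordAlgebra.left_induction with
    | algebraMap r =>
      rw [Algebra.algebraMap_eq_smul_one]
      exact Submodule.smul_mem _ _ (Submodule.mem_iSup_of_mem 0 one_mem_wordSpan)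
    | add x y hx hy => exact Submodule.add_mem _ hx hy
    | ι_mul x m hx =>
      induction hx using Submodule.iSup_induction' with
      | mem p x hx =>
        exact Submodule.mem_iSup_of_mem (p + 1) (mul_mem_wordSpan_of_mem_span
          (iota_basis_mul_self b) (iota_basis_mul_comm b hs hb) (iota_mem_span_basis b m) p hx)
      | zero => simp
      | add x y _ _ hx hy => rw [mul_add]; exact Submodule.add_mem _ hx hy
  refine ⟨?_⟩
  rw [← (Submodule.eq_top_iff'.mpr h)]
  exact Submodule.fg_iSup _ fun p => wordSpan_finite _ p

/-- The image in `ℂ ⊗ C(V)` of a vector of a basis of `V`. -/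
def genC (φ : LinearMap.BilinForm ℚ V) (b : ι → V) (i : ι) : ℂ ⊗[ℚ] Cl φ := iotaC φ (1 ⊗ₜ b i)

lemma genC_mul_self (i : ι) :
    genC φ b i * genC φ b i = algebraMap ℂ _ ((φ (b i) (b i) : ℚ) : ℂ) := by
  rw [genC, iotaC_mul_self]
  simp

lemma genC_mul_comm (hs : ∀ x y, φ x y = φ y x) (hb : ∀ i j, i ≠ j → φ (b i) (b j) = 0)
    (i j : ι) (hij : i ≠ j) : genC φ b i * genC φ b j = -(genC φ b j * genC φ b i) :=
  iotaC_mul_eq_neg hs (by simp [hb i j hij])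

lemma tmul_mem_wordSpan {x : Cl φ} {p : ZMod 2}
    (hx : x ∈ wordSpan ℚ (fun i => CliffordAlgebra.ι φ.toQuadraticMap (b i)) p) (z : ℂ) :
    z ⊗ₜ[ℚ] x ∈ wordSpan ℂ (genC φ b) p := by
  have hz : ∀ y : Cl φ, z ⊗ₜ[ℚ] y = z • ((1 : ℂ) ⊗ₜ[ℚ] y) := fun y => by
    simp [TensorProduct.smul_tmul']
  rw [hz]
  apply Submodule.smul_mem
  induction hx using Submodule.span_induction with
  | mem x hx =>
    obtain ⟨l, hl, rfl⟩ := hx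
    refine Submodule.subset_span ⟨l, hl, ?_⟩
    change _ = Algebra.TensorProduct.includeRight _
    rw [word, word, map_list_prod, List.map_map]
    rfl
  | zero => simp
  | add x y _ _ hx hy => rw [TensorProduct.tmul_add]; exact Submodule.add_mem _ hx hy
  | smul c x _ hx =>
    rw [TensorProduct.tmul_smul, TensorProduct.smul_tmul', Rat.smul_def, mul_one,
      ← mul_one (c : ℂ), ← smul_eq_mul, ← TensorProduct.smul_tmul']
    exact Submodule.smul_mem _ _ hx

lemma evenC_mem_wordSpan (hs : ∀ x y, φ x y = φ y x) (hb : ∀ i j, i ≠ j → φ (b i) (b j) = 0)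
    (u : ℂ ⊗[ℚ] ClEven φ) : evenC φ u ∈ wordSpan ℂ (genC φ b) 0 := by
  induction u using TensorProduct.induction_on with
  | zero => simp
  | tmul z x => exact tmul_mem_wordSpan b (mem_wordSpan_of_mem_even b hs hb x x.2) z
  | add x y hx hy => rw [map_add]; exact Submodule.add_mem _ hx hy

end CliffordBasis

/-! ### Reflections -/

section Reflections

variable {K E : Type*} [Field K] [AddCommGroup E] [Module K E] (B : LinearMap.BilinForm K E)

/-- The reflection `x ↦ x - 2 B(v, x) / B(v, v) v`. -/
def reflEnd (v : E) : Module.End K E := LinearMap.transvection (-(2 / B v v) • B v) v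

lemma reflEnd_apply (v x : E) : reflEnd B v x = x - (2 / B v v * B v x) • v := by
  simp [reflEnd, LinearMap.transvection.apply, sub_eq_add_neg]

variable {B}

lemma reflEnd_mul_self {v : E} (hv : B v v ≠ 0) : reflEnd B v * reflEnd B v = 1 := by
  ext x
  have : 2 / B v v * B v (reflEnd B v x) = -(2 / B v v * B v x) := by
    simp only [reflEnd_apply, map_sub, map_smul, smul_eq_mul]
    field_simp
    ring
  rw [Module.End.mul_apply, reflEnd_apply, this, reflEnd_apply, Module.End.one_apply, neg_smul,
    sub_neg_eq_add, sub_add_cancel]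

lemma det_reflEnd [FiniteDimensional K E] {v : E} (hv : B v v ≠ 0) :
    LinearMap.det (reflEnd B v) = -1 := by
  rw [reflEnd, LinearMap.transvection.det]
  simp only [LinearMap.smul_apply, smul_eq_mul]
  field_simp
  ring

lemma reflEnd_of_orthogonal {v x : E} (h : B v x = 0) : reflEnd B v x = x := by
  simp [reflEnd_apply, h]

lemma reflEnd_isometry (hB : ∀ x y, B x y = B y x) {v : E} (hv : B v v ≠ 0) (x y : E) :
    B (reflEnd B v x) (reflEnd B v y) = B x y := by
  simp only [reflEnd_apply, map_sub, map_smul, LinearMap.sub_apply, LinearMap.smul_apply,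
    smul_eq_mul]
  rw [hB x v]
  field_simp
  ring

/-- If `y - x` is anisotropic, its reflection sends `y` to `x`. Otherwise `y + x` is anisotropic,
since `B(y-x,y-x) + B(y+x,y+x) = 4 B(x,x)`; its reflection sends `y` to `-x`, and the reflection in
`x` corrects the sign. All mirrors are in the span of `x` and `y`, which gives the last clause. `L'`
is `L` reversed. -/
lemma exists_reflEnd_prod_apply_eq (hB : ∀ x y, B x y = B y x) [NeZero (2 : K)] {x y : E}
    (hxy : B y y = B x x) (hx : B x x ≠ 0) :
    ∃ L L' : List E, (∀ v ∈ L, B v v ≠ 0) ∧ (∀ v ∈ L', B v v ≠ 0) ∧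
      (L'.map (reflEnd B)).prod * (L.map (reflEnd B)).prod = 1 ∧
      (L.map (reflEnd B)).prod y = x ∧
      ∀ z, B x z = 0 → B y z = 0 → (L.map (reflEnd B)).prod z = z := by
  have h2 : (2 : K) ≠ 0 := NeZero.ne 2
  have hyx : B y x = B x y := hB y x
  by_cases hm : B (y - x) (y - x) = 0
  · have hp : B (y + x) (y + x) ≠ 0 := by
      intro hp
      simp only [map_sub, map_add, LinearMap.sub_apply, LinearMap.add_apply, hyx, hxy] at hm hp
      have : 2 * (2 * B x x) = 0 := by linear_combination hm + hp
      simp_all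
    refine ⟨[x, y + x], [y + x, x], by simpa [hx] using hp, by simpa [hx] using hp, ?_, ?_, ?_⟩
    · simp only [List.map_cons, List.map_nil, List.prod_cons, List.prod_nil, mul_one]
      rw [mul_assoc, ← mul_assoc (reflEnd B x), reflEnd_mul_self hx, one_mul, reflEnd_mul_self hp]
    · have h1 : reflEnd B (y + x) y = -x := by
        have : 2 / B (y + x) (y + x) * B (y + x) y = 1 := by
          rw [div_mul_eq_mul_div, div_eq_one_iff_eq hp]
          simp only [map_add, LinearMap.add_apply, hyx, hxy]
          ring
        rw [reflEnd_apply, this, one_smul]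
        abel
      simp only [List.map_cons, List.map_nil, List.prod_cons, List.prod_nil, mul_one,
        Module.End.mul_apply, h1, map_neg]
      rw [reflEnd_apply, div_mul_cancel₀ _ hx, two_smul]
      abel
    · intro z hxz hyz
      simp only [List.map_cons, List.map_nil, List.prod_cons, List.prod_nil, mul_one,
        Module.End.mul_apply]
      rw [reflEnd_of_orthogonal (v := y + x) (by simp [hxz, hyz]), reflEnd_of_orthogonal hxz]
  · refine ⟨[y - x], [y - x], by simpa using hm, by simpa using hm, ?_, ?_, ?_⟩
    · simp [reflEnd_mul_self hm]
    · have : 2 / B (y - x) (y - x) * B (y - x) y = 1 := by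
        rw [div_mul_eq_mul_div, div_eq_one_iff_eq hm]
        simp only [map_sub, LinearMap.sub_apply, hyx, hxy]
        ring
      simp only [List.map_cons, List.map_nil, List.prod_cons, List.prod_nil, mul_one,
        reflEnd_apply, this, one_smul, sub_sub_cancel]
    · intro z hxz hyz
      simpa using reflEnd_of_orthogonal (v := y - x) (by simp [hxz, hyz])

/-- A weak form of the Cartan-Dieudonné theorem. -/
theorem exists_eq_reflEnd_prod (hB : ∀ x y, B x y = B y x) [NeZero (2 : K)] {n : ℕ}
    (b : Basis (Fin n) K E) (hb : ∀ i j, i ≠ j → B (b i) (b j) = 0) (hb0 : ∀ i, B (b i) (b i) ≠ 0)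
    (A : Module.End K E) (hA : ∀ x y, B (A x) (A y) = B x y) :
    ∃ L : List E, (∀ v ∈ L, B v v ≠ 0) ∧ A = (L.map (reflEnd B)).prod := by
  have hiso : ∀ L : List E, (∀ v ∈ L, B v v ≠ 0) → ∀ x y,
      B ((L.map (reflEnd B)).prod x) ((L.map (reflEnd B)).prod y) = B x y := by
    intro L hL
    induction L with
    | nil => simp
    | cons v L ih =>
      intro x y
      simp only [List.map_cons, List.prod_cons, Module.End.mul_apply]
      rw [reflEnd_isometry hB (hL v (by simp)), ih fun w hw => hL w (by simp [hw])]
  -- Induction on the number `m` of final basis vectors that `A` is not yet known to fix.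
  have key : ∀ m : ℕ, ∀ A : Module.End K E, (∀ x y, B (A x) (A y) = B x y) →
      (∀ i : Fin n, i.val + m < n → A (b i) = b i) →
      ∃ L : List E, (∀ v ∈ L, B v v ≠ 0) ∧ A = (L.map (reflEnd B)).prod := by
    intro m
    induction m with
    | zero =>
      intro A _ hfix
      exact ⟨[], by simp, b.ext fun i => by simpa using hfix i (by simp)⟩
    | succ m ih =>
      intro A hA hfix
      by_cases hm : m < n
      · let i : Fin n := ⟨n - m - 1, by omega⟩
        obtain ⟨L, L', hL, hL', hinv, hmap, hfixL⟩ :=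
          exists_reflEnd_prod_apply_eq hB (x := b i) (y := A (b i)) (hA _ _) (hb0 i)
        obtain ⟨L₁, hL₁, hA₁⟩ := ih ((L.map (reflEnd B)).prod * A)
          (fun x y => by rw [Module.End.mul_apply, Module.End.mul_apply, hiso L hL, hA]) (by
            intro j hj
            rw [Module.End.mul_apply]
            by_cases hij : j = i
            · rw [hij, hmap]
            · have hj' : j.val + (m + 1) < n := by
                have : j.val ≠ n - m - 1 := fun h => hij (Fin.ext h)
                omega
              -- `b j` is orthogonal to `b i` and, being fixed by the isometry `A`, also to `A (b
              -- i)`; so the new reflections do not move it.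
              rw [hfix j hj']
              refine hfixL _ (hb i j (Ne.symm hij)) ?_
              rw [← hfix j hj', hA]
              exact hb i j (Ne.symm hij))
        refine ⟨L' ++ L₁, by simpa [or_imp, forall_and] using ⟨hL', hL₁⟩, ?_⟩
        rw [List.map_append, List.prod_append, ← hA₁, ← mul_assoc, hinv, one_mul]
      · exact ih A hA fun j hj => by omega
  exact key n A hA fun i hi => by omega

lemma det_reflEnd_prod [FiniteDimensional K E] (L : List E) (hL : ∀ v ∈ L, B v v ≠ 0) :
    LinearMap.det (L.map (reflEnd B)).prod = (-1) ^ L.length := by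
  induction L with
  | nil => simp
  | cons v L ih =>
    rw [List.map_cons, List.prod_cons, map_mul, det_reflEnd (hL v (by simp)),
      ih fun w hw => hL w (by simp [hw]), List.length_cons, pow_succ']

lemma reflEnd_prod_mem_of_even (M : Submonoid (Module.End K E))
    (hM : ∀ v w, B v v ≠ 0 → B w w ≠ 0 → reflEnd B v * reflEnd B w ∈ M) :
    ∀ L : List E, (∀ v ∈ L, B v v ≠ 0) → Even L.length → (L.map (reflEnd B)).prod ∈ M
  | [], _, _ => by simp
  | [v], _, h => by simp at h
  | v :: w :: L, hL, h => by
    rw [List.map_cons, List.map_cons, List.prod_cons, List.prod_cons, ← mul_assoc]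
    refine M.mul_mem (hM v w (hL v (by simp)) (hL w (by simp)))
      (reflEnd_prod_mem_of_even M hM L (fun u hu => hL u (by simp [hu])) ?_)
    simpa [Nat.even_add_one] using h

end Reflections

/-! ### The vector representation -/

section Vector

variable {V : Type*} [AddCommGroup V] [Module ℚ V] (φ : LinearMap.BilinForm ℚ V)

variable {φ} in
-- Conjugation by an anisotropic vector is minus the reflection in it; the sign disappears in
-- products of two vectors.
lemma iotaC_mul_iotaC_reflEnd (hs : ∀ x y, φ x y = φ y x) {v : ℂ ⊗[ℚ] V}
    (hv : φ.baseChange ℂ v v ≠ 0) (x : ℂ ⊗[ℚ] V) : iotaC φ v * iotaC φ x =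
      -(iotaC φ (reflEnd (φ.baseChange ℂ) v x) * iotaC φ v) := by
  have h := iotaC_mul_add_swap φ v x
  rw [baseChange_comm hs x v, ← two_mul] at h
  have hc : 2 / φ.baseChange ℂ v v * φ.baseChange ℂ v x * φ.baseChange ℂ v v =
      2 * φ.baseChange ℂ v x := by field_simp
  rw [eq_sub_of_add_eq h, reflEnd_apply, map_sub, map_smul, sub_mul, smul_mul_assoc, iotaC_mul_self,
    Algebra.smul_def, ← map_mul (algebraMap ℂ (ℂ ⊗[ℚ] Cl φ)), hc, neg_sub]

variable [FiniteDimensional ℚ V]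

lemma evenC_mul_iotaC (g : cSpin φ) (v : ℂ ⊗[ℚ] V) :
    evenC φ (g : (ℂ ⊗[ℚ] ClEven φ)ˣ) * iotaC φ v =
      iotaC φ (rhoEnd φ g v) * evenC φ (g : (ℂ ⊗[ℚ] ClEven φ)ˣ) := by
  rw [iotaC_rhoEnd, conjBy_apply, mul_assoc, mul_assoc, ← map_mul, Units.inv_mul, map_one, mul_one]

/-- The relation `g v = A(v) g` contains no inverse, so it can be checked on generators of `V` by
direct computation. -/
lemma exists_rhoEnd_eq (g : (ℂ ⊗[ℚ] ClEven φ)ˣ) (A : Module.End ℂ (ℂ ⊗[ℚ] V))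
    (h : ∀ v, evenC φ g * iotaC φ v = iotaC φ (A v) * evenC φ g) :
    ∃ hg : g ∈ cSpin φ, rhoEnd φ ⟨g, hg⟩ = A := by
  have hc : ∀ v, conjBy φ g (iotaC φ v) = iotaC φ (A v) := fun v => by
    rw [conjBy_apply, ← mul_assoc, h, mul_assoc, ← map_mul, Units.mul_inv, map_one, mul_one]
  refine ⟨?_, LinearMap.ext fun v => iotaC_injective φ ?_⟩
  · rintro _ ⟨_, ⟨v, rfl⟩, rfl⟩
    exact ⟨A v, (hc v).symm⟩
  · rw [iotaC_rhoEnd, hc]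

/-- The form is recovered from anticommutators, which are central scalars and hence unchanged by
conjugation. -/
lemma rhoEnd_isometry (g : cSpin φ) (hs : ∀ x y, φ x y = φ y x) (v w : ℂ ⊗[ℚ] V) :
    φ.baseChange ℂ (rhoEnd φ g v) (rhoEnd φ g w) = φ.baseChange ℂ v w := by
  have hinj := (algebraMap ℂ (ℂ ⊗[ℚ] Cl φ)).injective
  have h2 : ∀ x y, φ.baseChange ℂ x y + φ.baseChange ℂ y x = 2 * φ.baseChange ℂ x y := fun x y => by
    rw [baseChange_comm hs y x, two_mul]
  refine mul_left_cancel₀ (two_ne_zero (α := ℂ)) (hinj ?_)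
  rw [← h2, ← h2, ← iotaC_mul_add_swap, ← iotaC_mul_add_swap, iotaC_rhoEnd, iotaC_rhoEnd]
  have hm : ∀ x y, conjBy φ g (x * y) = conjBy φ g x * conjBy φ g y := fun x y => by
    simp only [conjBy_apply, mul_assoc]
    rw [← mul_assoc (evenC φ _) (evenC φ _), ← map_mul (evenC φ), Units.inv_mul, map_one, one_mul]
  rw [← hm, ← hm, ← map_add, iotaC_mul_add_swap, conjBy_apply, Algebra.commutes, ← mul_assoc,
    ← map_mul, Units.mul_inv, map_one, one_mul]

/-- The lift is the product `v w`, with inverse `w v / (φ(v,v) φ(w,w))`. -/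
lemma exists_rhoEnd_eq_reflEnd_mul (hs : ∀ x y, φ x y = φ y x) (v w : ℂ ⊗[ℚ] V)
    (hv : φ.baseChange ℂ v v ≠ 0) (hw : φ.baseChange ℂ w w ≠ 0) :
    ∃ g : cSpin φ, rhoEnd φ g = reflEnd (φ.baseChange ℂ) v * reflEnd (φ.baseChange ℂ) w := by
  set c := φ.baseChange ℂ v v * φ.baseChange ℂ w w with hc
  have hc0 : c ≠ 0 := mul_ne_zero hv hw
  have hm : ∀ v w, mulC φ v w * mulC φ w v =
      algebraMap ℂ _ (φ.baseChange ℂ v v * φ.baseChange ℂ w w) := fun v w => by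
    apply evenC_injective φ
    rw [map_mul, evenC_mulC, evenC_mulC, mul_assoc, ← mul_assoc (iotaC φ w), iotaC_mul_self,
      Algebra.commutes, ← mul_assoc, iotaC_mul_self, ← map_mul, AlgHom.commutes]
  let g : (ℂ ⊗[ℚ] ClEven φ)ˣ :=
    { val := mulC φ v w
      inv := c⁻¹ • mulC φ w v
      val_inv := by
        rw [mul_smul_comm, hm, ← hc, Algebra.algebraMap_eq_smul_one, smul_smul, inv_mul_cancel₀ hc0,
          one_smul]
      inv_val := by
        rw [smul_mul_assoc, hm, mul_comm (φ.baseChange ℂ w w), ← hc,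
          Algebra.algebraMap_eq_smul_one, smul_smul, inv_mul_cancel₀ hc0, one_smul] }
  obtain ⟨hg, h⟩ := exists_rhoEnd_eq φ g
    (reflEnd (φ.baseChange ℂ) v * reflEnd (φ.baseChange ℂ) w) (fun x => by
      change evenC φ (mulC φ v w) * _ = _ * evenC φ (mulC φ v w)
      rw [evenC_mulC, mul_assoc, iotaC_mul_iotaC_reflEnd hs hw, mul_neg, ← mul_assoc,
        iotaC_mul_iotaC_reflEnd hs hv, neg_mul, neg_neg, mul_assoc]
      rfl)
  exact ⟨⟨g, hg⟩, h⟩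

/-- Over `ℂ`, every rotation lies in the image of the vector representation. -/
lemma exists_rhoEnd_eq_of_det_eq_one (hs : ∀ x y, φ x y = φ y x) {n : ℕ} (b : Basis (Fin n) ℚ V)
    (hb : ∀ i j, i ≠ j → φ (b i) (b j) = 0) (hb0 : ∀ i, φ (b i) (b i) ≠ 0)
    (A : Module.End ℂ (ℂ ⊗[ℚ] V))
    (hA : ∀ x y, φ.baseChange ℂ (A x) (A y) = φ.baseChange ℂ x y) (hdet : LinearMap.det A = 1) :
    ∃ g : cSpin φ, rhoEnd φ g = A := by
  obtain ⟨L, hL, rfl⟩ := exists_eq_reflEnd_prod (baseChange_comm hs)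
    (Algebra.TensorProduct.basis ℂ b) (fun i j hij => by simp [hb i j hij])
    (fun i => by simpa using hb0 i) A hA
  -- Determinant `1` forces an even number of reflections, which are then lifted in pairs.
  rw [det_reflEnd_prod L hL, neg_one_pow_eq_one_iff_even (by norm_num)] at hdet
  exact reflEnd_prod_mem_of_even
    (MonoidHom.mrange ((Units.coeHom (Module.End ℂ (ℂ ⊗[ℚ] V))).comp (rho φ)))
    (fun v w hv hw => exists_rhoEnd_eq_reflEnd_mul φ hs v w hv hw) L hL hdet

end Vector

/-! ### Hodge structures of K3 type and the Kuga-Satake complex structure -/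

section Hodge

lemma HodgeStructure.linearMap_ext {W E : Type*} [AddCommGroup W] [Module ℚ W] [AddCommGroup E]
    [Module ℂ E] {n : ℤ} (H : HodgeStructure W n) {f g : ℂ ⊗[ℚ] W →ₗ[ℂ] E}
    (h : ∀ p, ∀ x ∈ H.piece p, f x = g x) : f = g := by
  refine LinearMap.ext fun x => ?_
  have hx : x ∈ ⨆ p, H.piece p := H.isInternal.submodule_iSup_eq_top ▸ Submodule.mem_top
  induction hx using Submodule.iSup_induction' with
  | mem p x hx => exact h p x hx
  | zero => simp
  | add x y _ _ hx hy => rw [map_add, map_add, hx, hy]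

variable {V : Type*} [AddCommGroup V] [Module ℚ V] {H : HodgeStructure V 2}
  {φ : LinearMap.BilinForm ℚ V} {ω : ℂ ⊗[ℚ] V}

lemma symm_of_isPolarization (hφ : H.IsPolarization φ ∨ H.IsPolarization (-φ)) (x y : V) :
    φ x y = φ y x := by
  rcases hφ with h | h
  · simpa using h.symm x y
  · simpa using h.symm x y

lemma baseChange_neg : (-φ).baseChange ℂ = -(φ.baseChange ℂ) := by
  ext
  simp

lemma orthogonal_of_isPolarization (hφ : H.IsPolarization φ ∨ H.IsPolarization (-φ)) {p r : ℤ}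
    (hpr : p + r ≠ 2) {x y : ℂ ⊗[ℚ] V} (hx : x ∈ H.piece p) (hy : y ∈ H.piece r) :
    φ.baseChange ℂ x y = 0 := by
  rcases hφ with h | h
  · exact h.orthogonal p r hpr x hx y hy
  · simpa [baseChange_neg] using h.orthogonal p r hpr x hx y hy

lemma baseChange_conjC_ne_zero (hφ : H.IsPolarization φ ∨ H.IsPolarization (-φ)) {p : ℤ}
    {x : ℂ ⊗[ℚ] V} (hx : x ∈ H.piece p) (hx0 : x ≠ 0) : φ.baseChange ℂ x (conjC V x) ≠ 0 := by
  intro h0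
  rcases hφ with h | h
  · simpa [h0] using h.pos p x hx hx0
  · simpa [baseChange_neg, h0] using h.pos p x hx hx0

lemma HodgeStructure.IsK3Type.exists_smul_eq (hK3 : H.IsK3Type) (hω : ω ∈ H.piece 2) (hω0 : ω ≠ 0)
    {x : ℂ ⊗[ℚ] V} (hx : x ∈ H.piece 2) : ∃ c : ℂ, x = c • ω := by
  obtain ⟨c, hc⟩ := (finrank_eq_one_iff_of_nonzero' (⟨ω, hω⟩ : H.piece 2)
    (fun h => hω0 (congrArg Subtype.val h))).mp hK3.finrank_two_zero ⟨x, hx⟩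
  exact ⟨c, (congrArg Subtype.val hc).symm⟩

lemma HodgeStructure.IsK3Type.exists_smul_conjC_eq (hK3 : H.IsK3Type) (hω : ω ∈ H.piece 2)
    (hω0 : ω ≠ 0) {x : ℂ ⊗[ℚ] V} (hx : x ∈ H.piece 0) : ∃ c : ℂ, x = c • conjC V ω := by
  obtain ⟨c, hc⟩ := hK3.exists_smul_eq hω hω0 (H.conj_mem 0 x hx)
  exact ⟨starRingEnd ℂ c, by rw [← conjC_smul, ← hc, conjC_conjC]⟩

lemma HodgeStructure.IsK3Type.linearMap_ext {E : Type*} [AddCommGroup E] [Module ℂ E]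
    (hK3 : H.IsK3Type) (hω : ω ∈ H.piece 2) (hω0 : ω ≠ 0) {f g : ℂ ⊗[ℚ] V →ₗ[ℂ] E}
    (h2 : f ω = g ω) (h0 : f (conjC V ω) = g (conjC V ω)) (h1 : ∀ x ∈ H.piece 1, f x = g x) :
    f = g := by
  refine H.linearMap_ext fun p x hx => ?_
  by_cases hp2 : p = 2
  · subst hp2
    obtain ⟨c, rfl⟩ := hK3.exists_smul_eq hω hω0 hx
    rw [map_smul, map_smul, h2]
  by_cases hp0 : p = 0
  · subst hp0
    obtain ⟨c, rfl⟩ := hK3.exists_smul_conjC_eq hω hω0 hx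
    rw [map_smul, map_smul, h0]
  by_cases hp1 : p = 1
  · subst hp1
    exact h1 x hx
  · rw [hK3.effective p hp0 hp1 hp2, Submodule.mem_bot] at hx
    rw [hx, map_zero, map_zero]

/-- Pairing `x` with the conjugate of its component in `piece p` isolates that component, by
orthogonality of the pieces; definiteness then makes it vanish. -/
lemma eq_zero_of_forall_baseChange_eq_zero (hφ : H.IsPolarization φ ∨ H.IsPolarization (-φ))
    (x : ℂ ⊗[ℚ] V) (h : ∀ y, φ.baseChange ℂ x y = 0) : x = 0 := by
  classical
  obtain ⟨d, rfl⟩ := H.sum_bijective.surjective x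
  suffices hd : ∀ p, (d p : ℂ ⊗[ℚ] V) = 0 by
    have : d = 0 := DFinsupp.ext fun p => Subtype.ext (hd p)
    rw [this, map_zero]
  intro p
  by_contra hp
  refine baseChange_conjC_ne_zero hφ (d p).2 hp ?_
  have h1 := h (conjC V (d p))
  rw [DirectSum.coeLinearMap_eq_dfinsuppSum, DFinsupp.sum, map_sum, LinearMap.sum_apply,
    Finset.sum_eq_single p] at h1
  · exact h1
  · intro r _ hr
    exact orthogonal_of_isPolarization hφ (by omega) (d r).2 (H.conj_mem p _ (d p).2)
  · intro hps
    rw [DFinsupp.notMem_support_iff] at hps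
    simp [hps]

lemma exists_orthogonal_basis_of_isPolarization [FiniteDimensional ℚ V]
    (hφ : H.IsPolarization φ ∨ H.IsPolarization (-φ)) :
    ∃ b : Basis (Fin (finrank ℚ V)) ℚ V, (∀ i j, i ≠ j → φ (b i) (b j) = 0) ∧
      ∀ i, φ (b i) (b i) ≠ 0 := by
  have : Invertible (2 : ℚ) := invertibleOfNonzero two_ne_zero
  have hs := symm_of_isPolarization hφ
  obtain ⟨b, hb⟩ := LinearMap.BilinForm.exists_orthogonal_basis (B := φ) ⟨fun x y => hs x y⟩
  refine ⟨b, fun i j hij => hb hij, fun i => ?_⟩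
  -- Nondegeneracy over `ℚ` descends from nondegeneracy over `ℂ`.
  refine hb.not_isOrtho_basis_self_of_separatingLeft (fun x hx => ?_) i
  have h1 : (1 : ℂ) ⊗ₜ[ℚ] x = 0 := by
    refine eq_zero_of_forall_baseChange_eq_zero hφ _ fun y => ?_
    induction y using TensorProduct.induction_on with
    | zero => simp
    | tmul z y => simp [hx y]
    | add y z hy hz => rw [map_add, hy, hz, add_zero]
  exact (Module.FaithfullyFlat.one_tmul_eq_zero_iff ℚ V x).mp h1

/-! ### Commutation of `J` with `V`, and the lift of the Hodge homomorphism -/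

section ComplexStructure

variable (hφ : H.IsPolarization φ ∨ H.IsPolarization (-φ)) (hω : ω ∈ H.piece 2) (hω0 : ω ≠ 0)

include hφ hω

lemma iotaC_omega_mul_self : iotaC φ ω * iotaC φ ω = 0 := by
  rw [iotaC_mul_self, orthogonal_of_isPolarization hφ (by norm_num) hω hω, map_zero]

lemma iotaC_conj_omega_mul_self : iotaC φ (conjC V ω) * iotaC φ (conjC V ω) = 0 := by
  rw [iotaC_mul_self, orthogonal_of_isPolarization hφ (by norm_num) (H.conj_mem 2 ω hω)
    (H.conj_mem 2 ω hω), map_zero]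

omit hω in
lemma iotaC_omega_mul_add_swap :
    iotaC φ ω * iotaC φ (conjC V ω) + iotaC φ (conjC V ω) * iotaC φ ω =
      algebraMap ℂ _ (2 * φ.baseChange ℂ ω (conjC V ω)) := by
  rw [iotaC_mul_add_swap, baseChange_comm (symm_of_isPolarization hφ) (conjC V ω), two_mul]

/-- Since `ω` and `conj ω` have square zero, only the mixed terms of the product of real and
imaginary part remain. As a multiple of a commutator, `J` is easy to multiply with `ω` and `conj ω`.
-/
lemma evenC_complexStructure : evenC φ (complexStructure φ ω) =
    (2 * Complex.I * φ.baseChange ℂ ω (conjC V ω))⁻¹ •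
      (iotaC φ (conjC V ω) * iotaC φ ω - iotaC φ ω * iotaC φ (conjC V ω)) := by
  have a11 : φ.baseChange ℂ (reC ω) (reC ω) = φ.baseChange ℂ ω (conjC V ω) / 2 := by
    simp only [reC, map_smul, map_add, LinearMap.smul_apply, LinearMap.add_apply, smul_eq_mul,
      orthogonal_of_isPolarization hφ (p := 2) (r := 2) (by norm_num) hω hω,
      orthogonal_of_isPolarization hφ (p := 2 - 2) (r := 2 - 2) (by norm_num) (H.conj_mem 2 ω hω)
        (H.conj_mem 2 ω hω), baseChange_comm (symm_of_isPolarization hφ) (conjC V ω) ω]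
    ring
  rw [complexStructure, a11, map_smul, evenC_mulC, reC, imC, map_smul, map_smul, map_add, map_sub,
    smul_mul_smul_comm, smul_smul, add_mul, mul_sub, mul_sub, iotaC_omega_mul_self hφ hω,
    iotaC_conj_omega_mul_self hφ hω, zero_sub, sub_zero, neg_add_eq_sub]
  congr 1
  rw [← mul_inv, ← mul_inv]
  congr 1
  ring

include hω0

/-- The squares of `ω` and `conj ω` vanish and their anticommutator is the scalar `2c`, `c = φ(ω,
conj ω)`. So `ω (conj ω) ω = 2c ω`, and likewise with the roles exchanged. -/
lemma complexStructure_mul_omega :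
    evenC φ (complexStructure φ ω) * iotaC φ ω = Complex.I • iotaC φ ω ∧
    iotaC φ ω * evenC φ (complexStructure φ ω) = -Complex.I • iotaC φ ω ∧
    evenC φ (complexStructure φ ω) * iotaC φ (conjC V ω) = -Complex.I • iotaC φ (conjC V ω) ∧
    iotaC φ (conjC V ω) * evenC φ (complexStructure φ ω) = Complex.I • iotaC φ (conjC V ω) := by
  have hc := baseChange_conjC_ne_zero hφ hω hω0
  have h1 := iotaC_omega_mul_self hφ hω
  have h2 := iotaC_conj_omega_mul_self hφ hω
  have h3 := iotaC_omega_mul_add_swap (ω := ω) hφ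
  rw [evenC_complexStructure hφ hω]
  set c := φ.baseChange ℂ ω (conjC V ω)
  set w := iotaC φ ω
  set w' := iotaC φ (conjC V ω)
  have hwww : w * w' * w = (2 * c) • w := by
    rw [eq_sub_of_add_eq h3, sub_mul, mul_assoc w', h1, mul_zero, sub_zero, Algebra.smul_def]
  have hwww' : w' * w * w' = (2 * c) • w' := by
    rw [eq_sub_of_add_eq' h3, sub_mul, mul_assoc w, h2, mul_zero, sub_zero, Algebra.smul_def]
  have hI : (2 * Complex.I * c)⁻¹ * (2 * c) = -Complex.I := by
    have := Complex.I_ne_zero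
    field_simp
    simp
  refine ⟨?_, ?_, ?_, ?_⟩
  · rw [smul_mul_assoc, sub_mul, hwww, mul_assoc w', h1, mul_zero, zero_sub, smul_neg, smul_smul,
      hI, neg_smul, neg_neg]
  · rw [mul_smul_comm, mul_sub, ← mul_assoc, hwww, ← mul_assoc, h1, zero_mul, sub_zero, smul_smul,
      hI]
  · rw [smul_mul_assoc, sub_mul, hwww', mul_assoc w, h2, mul_zero, sub_zero, smul_smul, hI]
  · rw [mul_smul_comm, mul_sub, ← mul_assoc, ← mul_assoc, hwww', h2, zero_mul, zero_sub, smul_neg,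
      smul_smul, hI, neg_smul, neg_neg]

omit hω0 in
-- `y` anticommutes with `ω` and `conj ω`, hence commutes with their products.
lemma complexStructure_mul_iotaC_comm {y : ℂ ⊗[ℚ] V} (hy : y ∈ H.piece 1) :
    evenC φ (complexStructure φ ω) * iotaC φ y = iotaC φ y * evenC φ (complexStructure φ ω) := by
  have h1 : iotaC φ ω * iotaC φ y = -(iotaC φ y * iotaC φ ω) :=
    iotaC_mul_eq_neg (symm_of_isPolarization hφ)
      (orthogonal_of_isPolarization hφ (by norm_num) hω hy)
  have h2 : iotaC φ (conjC V ω) * iotaC φ y = -(iotaC φ y * iotaC φ (conjC V ω)) :=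
    iotaC_mul_eq_neg (symm_of_isPolarization hφ)
      (orthogonal_of_isPolarization hφ (by norm_num) (H.conj_mem 2 ω hω) hy)
  have h3 : ∀ s t r : ℂ ⊗[ℚ] Cl φ, s * r = -(r * s) → t * r = -(r * t) →
      s * t * r = r * (s * t) := fun s t r hs ht => by
    rw [mul_assoc, ht, mul_neg, ← mul_assoc, hs, neg_mul, neg_neg, mul_assoc]
  rw [evenC_complexStructure hφ hω, smul_mul_assoc, mul_smul_comm, sub_mul, mul_sub,
    h3 _ _ _ h1 h2, h3 _ _ _ h2 h1]

variable [FiniteDimensional ℚ V] (hK3 : H.IsK3Type)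

include hK3

/-- The lift is `g = a + bJ` for `z = a + bi`. The hypotheses say `|u| = 1` and `u ^ 2 = z / conj
z`, the factor by which conjugation by `g` multiplies `ω`. The cases needed are `u = z/|z|`, and `u
= z` on the unit circle. -/
lemma exists_sigma_eq_deligneHom (z u : ℂˣ)
    (hu : (u : ℂ) * starRingEnd ℂ (u : ℂ) = 1)
    (hzu : (u : ℂ) ^ 2 * starRingEnd ℂ (z : ℂ) = z) :
    ∃ g : cSpin φ, sigma φ g = (kugaSatake φ H hφ ω hω hω0).deligneHom z ∧
      rho φ g = H.deligneHom u := by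
  set J := complexStructure φ ω with hJdef
  have hJ : J * J = -1 := complexStructure_sq_of_polarization φ H hφ ω hω hω0
  set a : ℂ := ((z : ℂ).re : ℂ) with ha
  set b : ℂ := ((z : ℂ).im : ℂ) with hb
  have hz : (z : ℂ) = a + b * Complex.I := (Complex.re_add_im _).symm
  have hzc : starRingEnd ℂ (z : ℂ) = a - b * Complex.I := by
    rw [hz, map_add, map_mul, ha, hb, Complex.conj_ofReal, Complex.conj_ofReal, Complex.conj_I]
    ring
  have hN : a * a + b * b = z * starRingEnd ℂ (z : ℂ) := by
    rw [hzc, hz]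
    linear_combination (b * b) * Complex.I_sq
  have hN0 : a * a + b * b ≠ 0 := by
    rw [hN]
    exact mul_ne_zero z.ne_zero ((map_ne_zero _).mpr z.ne_zero)
  have hprod : (a • (1 : ℂ ⊗[ℚ] ClEven φ) + b • J) * (a • 1 - b • J) = (a * a + b * b) • 1 := by
    simp only [add_mul, mul_sub, smul_mul_smul_comm, mul_one, one_mul, hJ, smul_neg, add_smul,
      mul_comm b a]
    abel
  have hprod' : (a • (1 : ℂ ⊗[ℚ] ClEven φ) - b • J) * (a • 1 + b • J) = (a * a + b * b) • 1 := by
    simp only [sub_mul, mul_add, smul_mul_smul_comm, mul_one, one_mul, hJ, smul_neg, add_smul,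
      mul_comm b a]
    abel
  let g : (ℂ ⊗[ℚ] ClEven φ)ˣ :=
    { val := a • 1 + b • J
      inv := (a * a + b * b)⁻¹ • (a • 1 - b • J)
      val_inv := by rw [mul_smul_comm, hprod, smul_smul, inv_mul_cancel₀ hN0, one_smul]
      inv_val := by rw [smul_mul_assoc, hprod', smul_smul, inv_mul_cancel₀ hN0, one_smul] }
  have hgv : (g : ℂ ⊗[ℚ] ClEven φ) = a • 1 + b • J := rfl
  have hg : evenC φ g = a • 1 + b • evenC φ J := by rw [hgv, map_add, map_smul, map_smul, map_one]
  obtain ⟨j1, j2, j3, j4⟩ := complexStructure_mul_omega hφ hω hω0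
  have hucz : starRingEnd ℂ (u : ℂ) ^ 2 * z = starRingEnd ℂ (z : ℂ) := by
    linear_combination (-starRingEnd ℂ (u : ℂ) ^ 2) * hzu +
      (starRingEnd ℂ (z : ℂ) * ((u : ℂ) * starRingEnd ℂ (u : ℂ) + 1)) * hu
  have hA : ∀ v, evenC φ g * iotaC φ v =
      iotaC φ ((H.deligneHom u : Module.End ℂ (ℂ ⊗[ℚ] V)) v) * evenC φ g := by
    have := hK3.linearMap_ext hω hω0 (f := LinearMap.mulLeft ℂ (evenC φ g) ∘ₗ iotaC φ)
      (g := LinearMap.mulRight ℂ (evenC φ g) ∘ₗ iotaC φ ∘ₗ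
        (H.deligneHom u : Module.End ℂ (ℂ ⊗[ℚ] V))) ?_ ?_ ?_
    · exact fun v => LinearMap.congr_fun this v
    · simp only [LinearMap.comp_apply, LinearMap.mulLeft_apply, LinearMap.mulRight_apply]
      rw [H.deligneHom_apply u 2 ω hω, hg, map_smul, smul_mul_assoc, add_mul, mul_add,
        smul_mul_assoc, smul_mul_assoc, mul_smul_comm, mul_smul_comm, one_mul, mul_one, j1, j2,
        smul_smul, smul_smul, ← add_smul, ← add_smul, smul_smul]
      congr 1
      simp only [sub_self, pow_zero, mul_one, zpow_ofNat, mul_neg]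
      rw [← sub_eq_add_neg, ← hzc, hzu, hz]
    · simp only [LinearMap.comp_apply, LinearMap.mulLeft_apply, LinearMap.mulRight_apply]
      rw [H.deligneHom_apply u (2 - 2) _ (H.conj_mem 2 ω hω), hg, map_smul, smul_mul_assoc, add_mul,
        mul_add, smul_mul_assoc, smul_mul_assoc, mul_smul_comm, mul_smul_comm, one_mul, mul_one, j3,
        j4, smul_smul, smul_smul, ← add_smul, ← add_smul, smul_smul]
      congr 1
      simp only [sub_self, pow_zero, one_mul, sub_zero, zpow_ofNat, mul_neg]
      rw [← sub_eq_add_neg, ← hzc, ← hz, hucz]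
    · intro y hy
      simp only [LinearMap.comp_apply, LinearMap.mulLeft_apply, LinearMap.mulRight_apply]
      rw [H.deligneHom_apply u 1 y hy, hg, add_mul, smul_mul_assoc, smul_mul_assoc, one_mul,
        complexStructure_mul_iotaC_comm hφ hω hy, ← hJdef]
      norm_num [hu, mul_add]
  obtain ⟨hgc, hρ⟩ := exists_rhoEnd_eq φ g _ hA
  refine ⟨⟨g, hgc⟩, Units.ext ?_, Units.ext hρ⟩
  refine (kugaSatake φ H hφ ω hω hω0).linearMap_ext fun p x hx => ?_
  rw [HodgeStructure.deligneHom_apply _ z p x hx]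
  change (a • (1 : ℂ ⊗[ℚ] ClEven φ) + b • J) * x = _
  rw [add_mul, smul_mul_assoc, smul_mul_assoc, one_mul]
  change x ∈ ksPiece φ ω p at hx
  by_cases hp1 : p = 1
  · subst hp1
    have hx' : J * x = Complex.I • x := by
      simpa [ksPiece, Module.End.mem_eigenspace_iff] using hx
    rw [hx', smul_smul, ← add_smul, ← hz]
    simp
  by_cases hp0 : p = 0
  · subst hp0
    have hx' : J * x = -Complex.I • x := by
      simpa [ksPiece, Module.End.mem_eigenspace_iff] using hx
    rw [hx', smul_smul, ← add_smul, mul_neg, ← sub_eq_add_neg, ← hzc]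
    simp
  · have : x = 0 := by simpa [ksPiece, hp1, hp0] using hx
    simp [this]

end ComplexStructure

end Hodge

/-! ### The preimage of an algebraic group under `ρ` is algebraic -/

section Preimage

variable {V : Type*} [AddCommGroup V] [Module ℚ V] (φ : LinearMap.BilinForm ℚ V)

lemma evenC_eq_baseChange (x : ℂ ⊗[ℚ] ClEven φ) :
    evenC φ x = (CliffordAlgebra.even φ.toQuadraticMap).val.toLinearMap.baseChange ℂ x := rfl

/-- A linear retraction of the inclusion `V → C(V)`. -/
def iotaRetraction : Cl φ →ₗ[ℚ] V :=
  ((CliffordAlgebra.ι φ.toQuadraticMap).exists_leftInverse_of_injective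
    (LinearMap.ker_eq_bot.mpr (iota_injective φ))).choose

lemma iotaRetraction_comp : iotaRetraction φ ∘ₗ CliffordAlgebra.ι φ.toQuadraticMap = LinearMap.id :=
  ((CliffordAlgebra.ι φ.toQuadraticMap).exists_leftInverse_of_injective
    (LinearMap.ker_eq_bot.mpr (iota_injective φ))).choose_spec

/-- A linear retraction of the inclusion `C⁺(V) → C(V)`. -/
def evenRetraction : Cl φ →ₗ[ℚ] ClEven φ :=
  ((CliffordAlgebra.even φ.toQuadraticMap).val.toLinearMap.exists_leftInverse_of_injective
    (LinearMap.ker_eq_bot.mpr Subtype.val_injective)).choose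

lemma evenRetraction_comp :
    evenRetraction φ ∘ₗ (CliffordAlgebra.even φ.toQuadraticMap).val.toLinearMap = LinearMap.id :=
  ((CliffordAlgebra.even φ.toQuadraticMap).val.toLinearMap.exists_leftInverse_of_injective
    (LinearMap.ker_eq_bot.mpr Subtype.val_injective)).choose_spec

/-- `V` is the kernel of the rational projector `π`, and every functional composed with `π` kills
`V`; so the rational linear equations of `V` still define it over `ℂ`. -/
lemma mem_range_iotaC_of_dual [FiniteDimensional ℚ (Cl φ)] (x : ℂ ⊗[ℚ] Cl φ)
    (h : ∀ ℓ : Dual ℚ (Cl φ), ℓ ∘ₗ CliffordAlgebra.ι φ.toQuadraticMap = 0 →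
      Dual.baseChange ℂ ℓ x = 0) : x ∈ LinearMap.range (iotaC φ) := by
  set π : Cl φ →ₗ[ℚ] Cl φ :=
    LinearMap.id - CliffordAlgebra.ι φ.toQuadraticMap ∘ₗ iotaRetraction φ with hπ
  have h0 : π.baseChange ℂ x = 0 := by
    refine eq_zero_of_dual_baseChange _ fun ℓ => ?_
    rw [dual_baseChange_comp]
    refine h _ ?_
    rw [LinearMap.comp_assoc, hπ, LinearMap.sub_comp, LinearMap.comp_assoc, iotaRetraction_comp]
    simp
  rw [hπ, LinearMap.baseChange_sub, LinearMap.baseChange_id, LinearMap.baseChange_comp,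
    LinearMap.sub_apply, sub_eq_zero] at h0
  exact ⟨(iotaRetraction φ).baseChange ℂ x, h0.symm⟩

variable [FiniteDimensional ℚ V]

lemma sigma_apply (g : cSpin φ) (x : ℂ ⊗[ℚ] ClEven φ) :
    (sigma φ g : Module.End ℂ (ℂ ⊗[ℚ] ClEven φ)) x = (g : (ℂ ⊗[ℚ] ClEven φ)ˣ) * x := rfl

lemma rho_coe (g : cSpin φ) : (rho φ g : Module.End ℂ (ℂ ⊗[ℚ] V)) = rhoEnd φ g := rfl

lemma sigma_inv_apply (g : cSpin φ) (x : ℂ ⊗[ℚ] ClEven φ) :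
    (((sigma φ g)⁻¹ : GLC (ClEven φ)) : Module.End ℂ (ℂ ⊗[ℚ] ClEven φ)) x =
      ((g : (ℂ ⊗[ℚ] ClEven φ)ˣ)⁻¹ : (ℂ ⊗[ℚ] ClEven φ)ˣ) * x := by
  rw [← map_inv]
  rfl

/-- For `A` in the image of `σ`, the vector `ρ(σ⁻¹ A) v` inside `C(V)`. -/
def conjVector (A : GLC (ClEven φ)) (v : V) : ℂ ⊗[ℚ] Cl φ :=
  evenC φ ((A : Module.End ℂ (ℂ ⊗[ℚ] ClEven φ)) (1 ⊗ₜ 1)) * (iotaC φ (1 ⊗ₜ v) *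
    evenC φ (((A⁻¹ : GLC (ClEven φ)) : Module.End ℂ (ℂ ⊗[ℚ] ClEven φ)) (1 ⊗ₜ 1)))

lemma conjVector_sigma (g : cSpin φ) (v : V) :
    conjVector φ (sigma φ g) v = iotaC φ (rhoEnd φ g (1 ⊗ₜ v)) := by
  rw [iotaC_rhoEnd, conjBy_apply, conjVector, sigma_apply, sigma_inv_apply]
  change evenC φ (_ * 1) * (_ * evenC φ (_ * 1)) = _
  rw [mul_one, mul_one]

omit [FiniteDimensional ℚ V] in
lemma hasCoordsIn_conjVector [FiniteDimensional ℚ (Cl φ)] (v : V) :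
    HasCoordsIn (regFun (ClEven φ)) fun A => conjVector φ A v := by
  simp only [conjVector, evenC_eq_baseChange]
  exact (((hasCoordsIn_polyFun_apply 1).mono polyFun_le_regFun).baseChange _).mul
    ((by simpa [iotaC] using HasCoordsIn.const _ : HasCoordsIn _ fun _ => iotaC φ (1 ⊗ₜ v)).mul
      ((hasCoordsIn_regFun_inv_apply 1).baseChange _))

/-- By `h1`, `A` is left multiplication by `u = A(1)`, whose inverse is `A⁻¹(1)`; by `h2`,
conjugation by `u` preserves `V`. -/
lemma exists_sigma_eq [FiniteDimensional ℚ (Cl φ)] (A : GLC (ClEven φ))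
    (h1 : ∀ x : ClEven φ, (A : Module.End ℂ (ℂ ⊗[ℚ] ClEven φ)) (1 ⊗ₜ x) =
      (A : Module.End ℂ (ℂ ⊗[ℚ] ClEven φ)) (1 ⊗ₜ 1) * (1 ⊗ₜ x))
    (h2 : ∀ v, conjVector φ A v ∈ LinearMap.range (iotaC φ)) : ∃ g, sigma φ g = A := by
  set u := (A : Module.End ℂ (ℂ ⊗[ℚ] ClEven φ)) (1 ⊗ₜ 1) with hu
  set u' := ((A⁻¹ : GLC (ClEven φ)) : Module.End ℂ (ℂ ⊗[ℚ] ClEven φ)) (1 ⊗ₜ 1) with hu'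
  have hA : ∀ x, (A : Module.End ℂ (ℂ ⊗[ℚ] ClEven φ)) x = u * x := by
    intro x
    induction x using TensorProduct.induction_on with
    | zero => simp
    | tmul z x =>
      have hz : z ⊗ₜ[ℚ] x = z • ((1 : ℂ) ⊗ₜ[ℚ] x) := by simp [TensorProduct.smul_tmul']
      rw [hz, map_smul, h1, mul_smul_comm]
    | add x y hx hy => rw [map_add, hx, hy, mul_add]
  have hAA : ∀ x, ((A⁻¹ : GLC (ClEven φ)) : Module.End ℂ (ℂ ⊗[ℚ] ClEven φ))
      ((A : Module.End ℂ (ℂ ⊗[ℚ] ClEven φ)) x) = x := fun x => by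
    rw [← Module.End.mul_apply, Units.inv_mul, Module.End.one_apply]
  have huu' : u * u' = 1 := by
    rw [← hA, hu', ← Module.End.mul_apply, Units.mul_inv, Module.End.one_apply]
    rfl
  have hu'u : u' * u = 1 := by
    rw [← hAA (u' * u), hA, ← mul_assoc, huu', one_mul, hu, hAA]
    rfl
  let g : (ℂ ⊗[ℚ] ClEven φ)ˣ := ⟨u, u', huu', hu'u⟩
  have hg : g ∈ cSpin φ := by
    rintro _ ⟨_, ⟨v, rfl⟩, rfl⟩
    induction v using TensorProduct.induction_on with
    | zero => simp
    | tmul z v =>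
      have hz : z ⊗ₜ[ℚ] v = z • ((1 : ℂ) ⊗ₜ[ℚ] v) := by simp [TensorProduct.smul_tmul']
      rw [hz, map_smul, map_smul]
      exact Submodule.smul_mem _ _ (h2 v)
    | add x y hx hy => rw [map_add, map_add]; exact Submodule.add_mem _ hx hy
  exact ⟨⟨g, hg⟩, Units.ext (LinearMap.ext fun x => (hA x).symm)⟩

/-- Three families of equations suffice: `A` is a left multiplication; the vectors `conjVector φ A
v` lie in `V`; and their coordinates, read through the retraction onto `V`, satisfy the equations of
`G`. -/
lemma isAlgebraicOverQ_map_sigma_comap_rho [FiniteDimensional ℚ (Cl φ)] (G : Subgroup (GLC V))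
    (hG : IsAlgebraicOverQ G) : IsAlgebraicOverQ ((G.comap (rho φ)).map (sigma φ)) := by
  obtain ⟨S, hS⟩ := hG
  have hcoeff : ∀ g : cSpin φ, (fun c : V × Dual ℚ V =>
      Dual.baseChange ℂ (c.2 ∘ₗ iotaRetraction φ) (conjVector φ (sigma φ g) c.1)) =
      matrixCoeff (rho φ g) := fun g => by
    ext c
    rw [conjVector_sigma, iotaC, dual_baseChange_comp, LinearMap.comp_assoc, iotaRetraction_comp,
      LinearMap.comp_id]
    rfl
  refine isAlgebraicOverQ_of_regFun _
    ({f | ∃ (x : ClEven φ) (ℓ : Dual ℚ (ClEven φ)), f = fun A : GLC (ClEven φ) =>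
        Dual.baseChange ℂ ℓ ((A : Module.End ℂ (ℂ ⊗[ℚ] ClEven φ)) (1 ⊗ₜ x) -
          (A : Module.End ℂ (ℂ ⊗[ℚ] ClEven φ)) (1 ⊗ₜ 1) * (1 ⊗ₜ x))} ∪
      {f | ∃ (v : V) (ℓ : Dual ℚ (Cl φ)), ℓ ∘ₗ CliffordAlgebra.ι φ.toQuadraticMap = 0 ∧
        f = fun A : GLC (ClEven φ) => Dual.baseChange ℂ ℓ (conjVector φ A v)} ∪
      {f | ∃ P ∈ S, f = fun A : GLC (ClEven φ) => MvPolynomial.aeval (fun c : V × Dual ℚ V =>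
        Dual.baseChange ℂ (c.2 ∘ₗ iotaRetraction φ) (conjVector φ A c.1)) P}) ?_ ?_
  · rintro f ((⟨x, ℓ, rfl⟩ | ⟨v, ℓ, -, rfl⟩) | ⟨P, -, rfl⟩)
    · exact polyFun_le_regFun (((hasCoordsIn_polyFun_apply x).sub
        ((hasCoordsIn_polyFun_apply 1).mul (HasCoordsIn.const x))) ℓ)
    · exact hasCoordsIn_conjVector φ v ℓ
    · exact aeval_mem_of_forall_mem _ (fun (c : V × Dual ℚ V) A =>
        Dual.baseChange ℂ (c.2 ∘ₗ iotaRetraction φ) (conjVector φ A c.1))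
        (fun c => hasCoordsIn_conjVector φ c.1 _) P
  · intro A
    constructor
    · rintro ⟨g, hg, rfl⟩ f ((⟨x, ℓ, rfl⟩ | ⟨v, ℓ, hℓ, rfl⟩) | ⟨P, hP, rfl⟩)
      · simp only [sigma_apply]
        rw [mul_assoc, Algebra.TensorProduct.tmul_mul_tmul, one_mul, one_mul, sub_self, map_zero]
      · simp only [conjVector_sigma, iotaC, dual_baseChange_comp, hℓ]
        simp [Dual.baseChange]
      · simp only [hcoeff]
        exact (hS _).mp hg P hP
    · intro h
      obtain ⟨g, rfl⟩ := exists_sigma_eq φ A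
        (fun x => sub_eq_zero.mp (eq_zero_of_dual_baseChange _ fun ℓ =>
          h _ (Or.inl (Or.inl ⟨x, ℓ, rfl⟩))))
        (fun v => mem_range_iotaC_of_dual φ _ fun ℓ hℓ => h _ (Or.inl (Or.inr ⟨v, ℓ, hℓ, rfl⟩)))
      refine ⟨g, (hS _).mpr fun P hP => ?_, rfl⟩
      rw [← hcoeff]
      exact h _ (Or.inr ⟨P, hP, rfl⟩)

end Preimage

/-! ### Homotheties -/

section Homothety

variable {W : Type*} [AddCommGroup W] [Module ℚ W]

/-- The homothety of ratio `t`. -/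
def homothety (W : Type*) [AddCommGroup W] [Module ℚ W] (t : ℂˣ) : GLC W :=
  Units.map (algebraMap ℂ (Module.End ℂ (ℂ ⊗[ℚ] W)) : ℂ →* Module.End ℂ (ℂ ⊗[ℚ] W)) t

lemma homothety_apply (t : ℂˣ) (x : ℂ ⊗[ℚ] W) :
    (homothety W t : Module.End ℂ (ℂ ⊗[ℚ] W)) x = (t : ℂ) • x := rfl

lemma matrixCoeff_homothety_mul (t : ℂˣ) (g : GLC W) :
    matrixCoeff (homothety W t * g) = fun c => (t : ℂ) * matrixCoeff g c := by
  ext c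
  rw [matrixCoeff, Units.val_mul, Module.End.mul_apply, homothety_apply, map_smul, smul_eq_mul]
  rfl

lemma aeval_mul_left_of_isHomogeneous {σ : Type*} {P : MvPolynomial σ ℚ} {d : ℕ}
    (hP : P.IsHomogeneous d) (f : σ → ℂ) (t : ℂ) :
    MvPolynomial.aeval (fun c => t * f c) P = t ^ d * MvPolynomial.aeval f P := by
  rw [MvPolynomial.aeval_def, MvPolynomial.aeval_def, MvPolynomial.eval₂_eq, MvPolynomial.eval₂_eq,
    Finset.mul_sum]
  refine Finset.sum_congr rfl fun m hm => ?_
  rw [hP.degree_eq_sum_deg_support hm, Finset.prod_congr rfl fun i _ => mul_pow t (f i) (m i),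
    Finset.prod_mul_distrib, Finset.prod_pow_eq_pow_sum]
  ring

lemma aeval_mul_left_eq_sum {σ : Type*} (P : MvPolynomial σ ℚ) (f : σ → ℂ) (t : ℂ) :
    MvPolynomial.aeval (fun c => t * f c) P = ∑ d ∈ Finset.range (P.totalDegree + 1),
      t ^ d * MvPolynomial.aeval f (MvPolynomial.homogeneousComponent d P) := by
  conv_lhs => rw [← MvPolynomial.sum_homogeneousComponent P, map_sum]
  exact Finset.sum_congr rfl fun d _ => aeval_mul_left_of_isHomogeneous
    (MvPolynomial.homogeneousComponent_isHomogeneous d P) f t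

lemma eq_zero_of_forall_sum_pow_mul_eq_zero {N : ℕ} {a : ℕ → ℂ} {s : Set ℂ} (hs : s.Infinite)
    (h : ∀ t ∈ s, ∑ d ∈ Finset.range N, t ^ d * a d = 0) (d : ℕ) (hd : d < N) : a d = 0 := by
  set p : Polynomial ℂ := ∑ d ∈ Finset.range N, Polynomial.monomial d (a d) with hp
  have hp0 : p = 0 := Polynomial.eq_zero_of_infinite_isRoot p (hs.mono fun t ht => by
    change p.eval t = 0
    rw [hp, Polynomial.eval_finsetSum, ← h t ht]
    exact Finset.sum_congr rfl fun d _ => by rw [Polynomial.eval_monomial, mul_comm])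
  have := congrArg (Polynomial.coeff · d) hp0
  simpa [hp, Polynomial.finsetSum_coeff, Polynomial.coeff_monomial, hd] using this

/-- An algebraic group that contains the homotheties is defined by homogeneous polynomials. -/
lemma mem_iff_homogeneousComponent {G : Subgroup (GLC W)}
    {S : Set (MvPolynomial (W × Dual ℚ W) ℚ)}
    (hS : ∀ g, g ∈ G ↔ ∀ P ∈ S, MvPolynomial.aeval (matrixCoeff g) P = 0)
    (hG : ∀ t, homothety W t ∈ G) (g : GLC W) :
    g ∈ G ↔ ∀ P ∈ S, ∀ d,
      MvPolynomial.aeval (matrixCoeff g) (MvPolynomial.homogeneousComponent d P) = 0 := by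
  constructor
  · intro hg P hP d
    by_cases hd : d < P.totalDegree + 1
    -- The values of `P` at `t g` form a polynomial in `t`, zero for all `t ≠ 0`, whose coefficients
    -- are the values at `g` of the homogeneous components.
    · refine eq_zero_of_forall_sum_pow_mul_eq_zero
        (a := fun d => MvPolynomial.aeval (matrixCoeff g) (MvPolynomial.homogeneousComponent d P))
        (s := {0}ᶜ) (Set.finite_singleton 0).infinite_compl (fun t ht => ?_) d hd
      rw [← aeval_mul_left_eq_sum]
      have := (hS _).mp (G.mul_mem (hG (Units.mk0 t ht)) hg) P hP
      rwa [matrixCoeff_homothety_mul] at this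
    · rw [MvPolynomial.homogeneousComponent_eq_zero _ _ (by omega), map_zero]
  · intro h
    rw [hS]
    intro P hP
    rw [← MvPolynomial.sum_homogeneousComponent P, map_sum]
    exact Finset.sum_eq_zero fun d _ => h P hP d

/-- In weight `1`, `h(r)` is the homothety of ratio `r` for real `r`. A polynomial equation
restricted to homotheties is a polynomial in the ratio; vanishing at all nonzero reals, it vanishes
identically. -/
lemma homothety_mem_mumfordTate (H : HodgeStructure W 1) (t : ℂˣ) :
    homothety W t ∈ H.mumfordTate := by
  obtain ⟨S, hS⟩ := isAlgebraicOverQ_algebraicHull (Set.range H.deligneHom)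
  have hreal : ∀ r : ℝ, ∀ hr : (r : ℂ) ≠ 0, homothety W (Units.mk0 (r : ℂ) hr) ∈ H.mumfordTate := by
    intro r hr
    refine subset_algebraicHull _ ⟨Units.mk0 (r : ℂ) hr, Units.ext (H.linearMap_ext fun p x hx => ?_)⟩
    rw [H.deligneHom_apply _ p x hx, homothety_apply, Units.val_mk0, Complex.conj_ofReal,
      ← zpow_add₀ hr]
    simp
  have hinf : (((↑) : ℝ → ℂ) '' {0}ᶜ).Infinite :=
    (Set.finite_singleton (0 : ℝ)).infinite_compl.image Complex.ofReal_injective.injOn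
  refine (hS _).mpr fun P hP => ?_
  have hd : ∀ d < P.totalDegree + 1, MvPolynomial.aeval (matrixCoeff (1 : GLC W))
      (MvPolynomial.homogeneousComponent d P) = 0 := by
    refine eq_zero_of_forall_sum_pow_mul_eq_zero hinf ?_
    rintro _ ⟨r, hr, rfl⟩
    have hr' : (r : ℂ) ≠ 0 := Complex.ofReal_ne_zero.mpr hr
    rw [← aeval_mul_left_eq_sum]
    have := (hS _).mp (hreal r hr') P hP
    rwa [← mul_one (homothety W _), matrixCoeff_homothety_mul] at this
  rw [← mul_one (homothety W t), matrixCoeff_homothety_mul, aeval_mul_left_eq_sum]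
  exact Finset.sum_eq_zero fun d hd' => by rw [hd d (Finset.mem_range.mp hd'), mul_zero]

end Homothety

/-! ### Lifting rotations to the Clifford group by averaging -/

section Lift

variable {V : Type*} [AddCommGroup V] [Module ℚ V] (φ : LinearMap.BilinForm ℚ V) {n : ℕ}
  (b : Basis (Fin n) ℚ V)

/-- The average of `A(e_I) x e_I⁻¹`, up to a rational factor, over the products `e_I` of vectors of
an orthogonal basis. -/
def spinLift (A : Module.End ℂ (ℂ ⊗[ℚ] V)) : ℂ ⊗[ℚ] Cl φ →ₗ[ℂ] ℂ ⊗[ℚ] Cl φ :=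
  twistedSum (fun j => ((φ (b j) (b j) : ℚ) : ℂ)) (fun j => iotaC φ (A (1 ⊗ₜ b j))) (genC φ b)
    (List.finRange n)

/-- `A` enters only through the vectors `A(b j)`, never through an inverse. -/
lemma hasCoordsIn_spinLift [FiniteDimensional ℚ (Cl φ)] (x : Cl φ) :
    HasCoordsIn (polyFun V) fun A : GLC V => spinLift φ b A (1 ⊗ₜ x) := by
  unfold spinLift
  induction List.finRange n with
  | nil => exact HasCoordsIn.const x
  | cons _ l ih =>
    simp only [twistedSum_cons]
    refine (ih.rat_smul _).add (HasCoordsIn.mul ?_ (ih.mul ?_))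
    · exact (hasCoordsIn_polyFun_apply _).baseChange _
    · simpa [genC, iotaC] using HasCoordsIn.const _

variable [FiniteDimensional ℚ V] {φ}

lemma spinLift_rhoEnd_mul (g : cSpin φ) (y : ℂ ⊗[ℚ] Cl φ) :
    spinLift φ b (rhoEnd φ g) (evenC φ (g : (ℂ ⊗[ℚ] ClEven φ)ˣ) * y) =
      evenC φ (g : (ℂ ⊗[ℚ] ClEven φ)ˣ) * spinLift φ b 1 y :=
  twistedSum_mul _ _ _ _ (fun _ => (evenC_mul_iotaC φ g _).symm) _ _

omit [FiniteDimensional ℚ V] in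
lemma exists_spinLift_one_eq (hs : ∀ x y, φ x y = φ y x) (hb : ∀ i j, i ≠ j → φ (b i) (b j) = 0)
    (y : ℂ ⊗[ℚ] ClEven φ) : ∃ t : ℂ, spinLift φ b 1 (evenC φ y) = algebraMap ℂ _ t :=
  exists_twistedSum_eq_algebraMap (genC_mul_self b) (genC_mul_comm b hs hb) _
    (fun i => List.mem_finRange i) (evenC_mem_wordSpan b hs hb y)

/-- Write `x = g (g⁻¹ x)` and pull `g` out; what remains is the untwisted average of an even
element, a scalar. So `ρ(g)` determines `g` up to a scalar that may vanish. -/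
lemma exists_spinLift_eq_smul (hs : ∀ x y, φ x y = φ y x)
    (hb : ∀ i j, i ≠ j → φ (b i) (b j) = 0) (g : cSpin φ) (x : ℂ ⊗[ℚ] ClEven φ) :
    ∃ t : ℂ, spinLift φ b (rhoEnd φ g) (evenC φ x) =
      t • evenC φ (g : (ℂ ⊗[ℚ] ClEven φ)ˣ) := by
  obtain ⟨t, ht⟩ := exists_spinLift_one_eq b hs hb
    (((g : (ℂ ⊗[ℚ] ClEven φ)ˣ)⁻¹ : (ℂ ⊗[ℚ] ClEven φ)ˣ) * x)
  refine ⟨t, ?_⟩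
  rw [← Units.mul_inv_cancel_left (g : (ℂ ⊗[ℚ] ClEven φ)ˣ) x, map_mul, spinLift_rhoEnd_mul, ht,
    ← Algebra.commutes, ← Algebra.smul_def]

/-- If all values at rational `x` vanished, so would the value at `x = g`, by linearity; but that
value is `g` times the product of the numbers `2 φ(b j, b j)`. -/
lemma exists_spinLift_tmul_ne_zero (hb0 : ∀ i, φ (b i) (b i) ≠ 0) (g : cSpin φ) :
    ∃ x : ClEven φ, spinLift φ b (rhoEnd φ g) (evenC φ (1 ⊗ₜ x)) ≠ 0 := by
  by_contra! h
  have hzero : ∀ x : ℂ ⊗[ℚ] ClEven φ, spinLift φ b (rhoEnd φ g) (evenC φ x) = 0 := by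
    intro x
    induction x using TensorProduct.induction_on with
    | zero => simp
    | tmul z x =>
      have hz : z ⊗ₜ[ℚ] x = z • ((1 : ℂ) ⊗ₜ[ℚ] x) := by simp [TensorProduct.smul_tmul']
      rw [hz, map_smul, map_smul, h, smul_zero]
    | add x y hx hy => rw [map_add, map_add, hx, hy, add_zero]
  have h1 := hzero (g : (ℂ ⊗[ℚ] ClEven φ)ˣ)
  have h2 := spinLift_rhoEnd_mul b g 1
  have hone : spinLift φ b 1 1 = algebraMap ℂ _ ((List.finRange n).map fun j =>
      2 * ((φ (b j) (b j) : ℚ) : ℂ)).prod := twistedSum_one (genC_mul_self b) _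
  rw [mul_one, h1, hone] at h2
  have h3 := congrArg (evenC φ ((g : (ℂ ⊗[ℚ] ClEven φ)ˣ)⁻¹ : (ℂ ⊗[ℚ] ClEven φ)ˣ) * ·) h2
  simp only [mul_zero, ← mul_assoc, ← map_mul, Units.inv_mul, map_one, one_mul] at h3
  have h4 := (map_eq_zero_iff _ (algebraMap ℂ (ℂ ⊗[ℚ] Cl φ)).injective).mp h3.symm
  rw [List.prod_eq_zero_iff, List.mem_map] at h4
  obtain ⟨j, -, hj⟩ := h4
  exact hb0 j (by simpa using hj)

end Lift

/-! ### The rotations that lift to an algebraic group containing the homotheties -/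

section Image

variable {V : Type*} [AddCommGroup V] [Module ℚ V] (φ : LinearMap.BilinForm ℚ V)

/-- The complex points of `SO(φ)`. -/
def specialOrthogonal : Subgroup (GLC V) where
  carrier := {A | (∀ x y, φ.baseChange ℂ ((A : Module.End ℂ (ℂ ⊗[ℚ] V)) x)
    ((A : Module.End ℂ (ℂ ⊗[ℚ] V)) y) = φ.baseChange ℂ x y) ∧ detFun A = 1}
  one_mem' := ⟨fun x y => rfl, by simp [detFun]⟩
  mul_mem' := by
    rintro A B ⟨hA, hA'⟩ ⟨hB, hB'⟩
    refine ⟨fun x y => ?_, ?_⟩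
    · rw [Units.val_mul, Module.End.mul_apply, Module.End.mul_apply, hA, hB]
    · rw [detFun] at hA' hB' ⊢
      rw [Units.val_mul, map_mul, hA', hB', one_mul]
  inv_mem' := by
    rintro A ⟨hA, hA'⟩
    have hinv : ∀ x, (A : Module.End ℂ (ℂ ⊗[ℚ] V))
        (((A⁻¹ : GLC V) : Module.End ℂ (ℂ ⊗[ℚ] V)) x) = x := fun x => by
      rw [← Module.End.mul_apply, Units.mul_inv, Module.End.one_apply]
    refine ⟨fun x y => ?_, ?_⟩
    · rw [← hA, hinv, hinv]
    · have h : detFun A * detFun A⁻¹ = 1 := by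
        rw [detFun, detFun, ← map_mul, Units.mul_inv, map_one]
      rwa [hA', one_mul] at h

variable {φ}

lemma isometry_of_forall_tmul {A : Module.End ℂ (ℂ ⊗[ℚ] V)}
    (h : ∀ v w : V, φ.baseChange ℂ (A (1 ⊗ₜ v)) (A (1 ⊗ₜ w)) = φ.baseChange ℂ (1 ⊗ₜ v) (1 ⊗ₜ w))
    (x y : ℂ ⊗[ℚ] V) : φ.baseChange ℂ (A x) (A y) = φ.baseChange ℂ x y := by
  have hz : ∀ (z : ℂ) (v : V), z ⊗ₜ[ℚ] v = z • ((1 : ℂ) ⊗ₜ[ℚ] v) := fun z v => by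
    simp [TensorProduct.smul_tmul']
  induction x using TensorProduct.induction_on with
  | zero => simp
  | add x x' hx hx' => simp only [map_add, LinearMap.add_apply, hx, hx']
  | tmul z v =>
    induction y using TensorProduct.induction_on with
    | zero => simp
    | add y y' hy hy' => simp only [map_add, hy, hy']
    | tmul z' w =>
      rw [hz z v, hz z' w]
      simp only [map_smul, LinearMap.smul_apply, h]

variable [FiniteDimensional ℚ V] {n : ℕ} {b : Basis (Fin n) ℚ V}

/-- The functional on `C(V)` whose value at `g ∈ C⁺(V)` is a given matrix coefficient of the left
multiplication by `g`. -/
def leftMulCoeff (φ : LinearMap.BilinForm ℚ V) (c : ClEven φ × Dual ℚ (ClEven φ)) :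
    Dual ℚ (Cl φ) :=
  c.2 ∘ₗ LinearMap.mulRight ℚ c.1 ∘ₗ evenRetraction φ

/-- It allows polynomials in the matrix coefficients of `σ(g)` to be evaluated at any element of
`C(V)`, in particular at values of `spinLift`. -/
lemma leftMulCoeff_evenC (g : cSpin φ) (c : ClEven φ × Dual ℚ (ClEven φ)) :
    Dual.baseChange ℂ (leftMulCoeff φ c) (evenC φ (g : (ℂ ⊗[ℚ] ClEven φ)ˣ)) =
      matrixCoeff (sigma φ g) c := by
  rw [evenC_eq_baseChange, dual_baseChange_comp, leftMulCoeff, LinearMap.comp_assoc,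
    LinearMap.comp_assoc, evenRetraction_comp, LinearMap.comp_id, ← dual_baseChange_comp,
    matrixCoeff, sigma_apply]
  congr 1
  generalize ((g : (ℂ ⊗[ℚ] ClEven φ)ˣ) : ℂ ⊗[ℚ] ClEven φ) = u
  induction u using TensorProduct.induction_on with
  | zero => simp
  | tmul z x => simp
  | add x y hx hy => rw [map_add, hx, hy, add_mul]

/-- At `t g` the polynomial takes the value `t ^ d` times its value at `g`, and `t ≠ 0` for some
`x`, which may depend on `g`; hence the quantifier over `x`. The left side involves `g` only through
`ρ(g)`. -/
lemma aeval_spinLift_eq_zero_iff (hs : ∀ x y, φ x y = φ y x)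
    (hb : ∀ i j, i ≠ j → φ (b i) (b j) = 0) (hb0 : ∀ i, φ (b i) (b i) ≠ 0)
    {P : MvPolynomial (ClEven φ × Dual ℚ (ClEven φ)) ℚ} {d : ℕ} (hP : P.IsHomogeneous d)
    (g : cSpin φ) :
    (∀ x : ClEven φ, MvPolynomial.aeval (fun c => Dual.baseChange ℂ (leftMulCoeff φ c)
      (spinLift φ b (rhoEnd φ g) (1 ⊗ₜ (x : Cl φ)))) P = 0) ↔
      MvPolynomial.aeval (matrixCoeff (sigma φ g)) P = 0 := by
  have key : ∀ t : ℂ, MvPolynomial.aeval (fun c => Dual.baseChange ℂ (leftMulCoeff φ c)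
      (t • evenC φ (g : (ℂ ⊗[ℚ] ClEven φ)ˣ))) P =
      t ^ d * MvPolynomial.aeval (matrixCoeff (sigma φ g)) P := fun t => by
    simp only [map_smul, leftMulCoeff_evenC, smul_eq_mul]
    exact aeval_mul_left_of_isHomogeneous hP _ _
  have htmul : ∀ x : ClEven φ, (1 : ℂ) ⊗ₜ[ℚ] (x : Cl φ) = evenC φ (1 ⊗ₜ x) := fun x => by
    simp [evenC]
  simp only [htmul]
  constructor
  · intro h
    obtain ⟨x, hx⟩ := exists_spinLift_tmul_ne_zero b hb0 g
    obtain ⟨t, ht⟩ := exists_spinLift_eq_smul b hs hb g (1 ⊗ₜ x)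
    have h1 := h x
    rw [ht, key] at h1
    refine (mul_eq_zero.mp h1).resolve_left (pow_ne_zero _ fun h0 => hx ?_)
    rw [ht, h0, zero_smul]
  · intro h x
    obtain ⟨t, ht⟩ := exists_spinLift_eq_smul b hs hb g (1 ⊗ₜ x)
    rw [ht, key, h, mul_zero]

/-- The homogeneous equations of `M` at `σ(g)` can be read off from `ρ(g)`. This takes the place of
the fact that the kernel of `ρ` consists of scalars. -/
lemma mem_of_rho_eq (hs : ∀ x y, φ x y = φ y x)
    (hb : ∀ i j, i ≠ j → φ (b i) (b j) = 0) (hb0 : ∀ i, φ (b i) (b i) ≠ 0)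
    {M : Subgroup (GLC (ClEven φ))} (hM : IsAlgebraicOverQ M) (hhom : ∀ t, homothety _ t ∈ M)
    {g g' : cSpin φ} (hg : sigma φ g ∈ M) (h : rho φ g' = rho φ g) : sigma φ g' ∈ M := by
  obtain ⟨S, hS⟩ := hM
  have hmem := mem_iff_homogeneousComponent hS hhom
  have h' : rhoEnd φ g' = rhoEnd φ g := congrArg Units.val h
  rw [hmem] at hg ⊢
  intro P hP d
  have hd := MvPolynomial.homogeneousComponent_isHomogeneous d P
  rw [← aeval_spinLift_eq_zero_iff hs hb hb0 hd, h', aeval_spinLift_eq_zero_iff hs hb hb0 hd]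
  exact hg P hP d

/-- The rotations that lift to a given algebraic group containing the homotheties form an algebraic
group. -/
lemma isAlgebraicOverQ_inf_map_rho [FiniteDimensional ℚ (Cl φ)] (hs : ∀ x y, φ x y = φ y x)
    (hb : ∀ i j, i ≠ j → φ (b i) (b j) = 0) (hb0 : ∀ i, φ (b i) (b i) ≠ 0)
    {M : Subgroup (GLC (ClEven φ))} (hM : IsAlgebraicOverQ M) (hhom : ∀ t, homothety _ t ∈ M) :
    IsAlgebraicOverQ (specialOrthogonal φ ⊓ (M.comap (sigma φ)).map (rho φ)) := by
  obtain ⟨S, hS⟩ := hM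
  have hmem := mem_iff_homogeneousComponent hS hhom
  -- The equations of `SO(φ)`, and the homogeneous equations of `M` evaluated on the averaged lifts
  -- of `A`.
  refine isAlgebraicOverQ_of_regFun _
    ({f | ∃ v w : V, f = fun A : GLC V => φ.baseChange ℂ
        ((A : Module.End ℂ (ℂ ⊗[ℚ] V)) (1 ⊗ₜ v)) ((A : Module.End ℂ (ℂ ⊗[ℚ] V)) (1 ⊗ₜ w)) -
          φ.baseChange ℂ (1 ⊗ₜ v) (1 ⊗ₜ w)} ∪
      {f | f = detFun - 1} ∪
      {f | ∃ P ∈ S, ∃ (d : ℕ) (x : ClEven φ), f = fun A : GLC V =>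
        MvPolynomial.aeval (fun c => Dual.baseChange ℂ (leftMulCoeff φ c)
          (spinLift φ b (A : Module.End ℂ (ℂ ⊗[ℚ] V)) (1 ⊗ₜ (x : Cl φ))))
          (MvPolynomial.homogeneousComponent d P)}) ?_ ?_
  · refine Set.Subset.trans ?_ (polyFun_le_regFun (W := V))
    rintro f ((⟨v, w, rfl⟩ | rfl) | ⟨P, -, d, x, rfl⟩)
    · exact (polyFun V).sub_mem
        ((hasCoordsIn_polyFun_apply v).bilin (hasCoordsIn_polyFun_apply w))
        ((HasCoordsIn.const v).bilin (HasCoordsIn.const w))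
    · exact (polyFun V).sub_mem detFun_mem_polyFun (polyFun V).one_mem
    · exact aeval_mem_of_forall_mem _ (fun c (A : GLC V) => Dual.baseChange ℂ (leftMulCoeff φ c)
        (spinLift φ b (A : Module.End ℂ (ℂ ⊗[ℚ] V)) (1 ⊗ₜ (x : Cl φ))))
        (fun c => hasCoordsIn_spinLift φ b _ _) _
  · intro A
    constructor
    · rintro ⟨⟨hiso, hdet⟩, g, hg, rfl⟩ f ((⟨v, w, rfl⟩ | rfl) | ⟨P, hP, d, x, rfl⟩)
      · exact sub_eq_zero.mpr (hiso _ _)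
      · exact sub_eq_zero.mpr hdet
      · exact (aeval_spinLift_eq_zero_iff hs hb hb0
          (MvPolynomial.homogeneousComponent_isHomogeneous d P) g).mpr ((hmem _).mp hg P hP d) x
    · intro h
      have hiso := isometry_of_forall_tmul (φ := φ) (A := (A : Module.End ℂ (ℂ ⊗[ℚ] V)))
        fun v w => sub_eq_zero.mp (h _ (Or.inl (Or.inl ⟨v, w, rfl⟩)))
      have hdet : detFun A = 1 := sub_eq_zero.mp (h _ (Or.inl (Or.inr rfl)))
      -- The equations of `M` say something about a lift of `A` only once a lift exists; being a
      -- rotation guarantees one over `ℂ`.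
      obtain ⟨g, hg⟩ := exists_rhoEnd_eq_of_det_eq_one φ hs b hb hb0 _ hiso hdet
      refine ⟨⟨hiso, hdet⟩, g, (hmem _).mpr fun P hP d => ?_, Units.ext hg⟩
      refine (aeval_spinLift_eq_zero_iff hs hb hb0
        (MvPolynomial.homogeneousComponent_isHomogeneous d P) g).mp fun x => ?_
      rw [hg]
      exact h _ (Or.inr ⟨P, hP, d, x, rfl⟩)

/-- An isometry has determinant `±1`, so its square has determinant `1`. -/
lemma detFun_rho_mul_self (hs : ∀ x y, φ x y = φ y x)
    (hb : ∀ i j, i ≠ j → φ (b i) (b j) = 0) (hb0 : ∀ i, φ (b i) (b i) ≠ 0) (g : cSpin φ) :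
    detFun (rho φ (g * g)) = 1 := by
  obtain ⟨L, hL, hA⟩ := exists_eq_reflEnd_prod (baseChange_comm hs)
    (Algebra.TensorProduct.basis ℂ b) (fun i j hij => by simp [hb i j hij])
    (fun i => by simpa using hb0 i) _ (rhoEnd_isometry φ g hs)
  rw [detFun, map_mul, Units.val_mul, map_mul, rho_coe, hA, det_reflEnd_prod L hL, ← mul_pow]
  norm_num

end Image

end KugaSatake

end

/-! ### The two inclusions -/

theorem lemma1 {V : Type*} [AddCommGroup V] [Module ℚ V] [FiniteDimensional ℚ V]
    (H : KugaSatake.HodgeStructure V 2) (hK3 : H.IsK3Type)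
    (φ : LinearMap.BilinForm ℚ V)
    (hφ : H.IsPolarization φ ∨ H.IsPolarization (-φ))
    (ω : TensorProduct ℚ ℂ V) (hω : ω ∈ H.piece 2) (hω0 : ω ≠ 0) :
    (KugaSatake.kugaSatake φ H hφ ω hω hω0).mumfordTate =
      (H.hodgeGroup.comap (KugaSatake.rho φ)).map (KugaSatake.sigma φ) := by
  obtain ⟨b, hb, hb0⟩ := KugaSatake.exists_orthogonal_basis_of_isPolarization hφ
  have hs := KugaSatake.symm_of_isPolarization hφ
  have := KugaSatake.cliffordAlgebra_finite b hs hb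
  refine le_antisymm (KugaSatake.algebraicHull_le ?_ ?_) ?_
  · exact KugaSatake.isAlgebraicOverQ_map_sigma_comap_rho φ _
      (KugaSatake.isAlgebraicOverQ_algebraicHull _)
  · rintro _ ⟨z, rfl⟩
    have hz : (‖(z : ℂ)‖ : ℂ) ≠ 0 := by simp
    have hnorm : (z : ℂ) * starRingEnd ℂ (z : ℂ) = (‖(z : ℂ)‖ : ℂ) ^ 2 := Complex.mul_conj' _
    -- Real scalars act trivially on `V` through `ρ`, so only the direction of `z` matters.
    set u : ℂˣ := Units.mk0 ((z : ℂ) / ‖(z : ℂ)‖) (div_ne_zero z.ne_zero hz) with hu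
    have huv : (u : ℂ) = (z : ℂ) / ‖(z : ℂ)‖ := rfl
    obtain ⟨g, hσ, hρ⟩ := KugaSatake.exists_sigma_eq_deligneHom hφ hω hω0 hK3 z u
      (by
        rw [huv, map_div₀, Complex.conj_ofReal, div_mul_div_comm, hnorm]
        field_simp)
      (by
        rw [huv, div_pow, ← hnorm]
        have h1 : (z : ℂ) ≠ 0 := z.ne_zero
        have h2 : starRingEnd ℂ (z : ℂ) ≠ 0 := (map_ne_zero _).mpr h1
        field_simp)
    refine ⟨g, ?_, hσ⟩
    refine Subgroup.mem_comap.mpr ?_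
    rw [hρ]
    refine KugaSatake.subset_algebraicHull _ ⟨u, ?_, rfl⟩
    simp [huv]
  · have hM := KugaSatake.isAlgebraicOverQ_algebraicHull
      (Set.range (KugaSatake.kugaSatake φ H hφ ω hω hω0).deligneHom)
    have hhom := KugaSatake.homothety_mem_mumfordTate (KugaSatake.kugaSatake φ H hφ ω hω hω0)
    have hle : H.hodgeGroup ≤ KugaSatake.specialOrthogonal φ ⊓
        ((KugaSatake.kugaSatake φ H hφ ω hω hω0).mumfordTate.comap
          (KugaSatake.sigma φ)).map (KugaSatake.rho φ) := by
      refine KugaSatake.algebraicHull_le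
        (KugaSatake.isAlgebraicOverQ_inf_map_rho hs hb hb0 hM hhom) ?_
      rintro _ ⟨u, hu, rfl⟩
      have hu1 : ‖(u : ℂ)‖ = 1 := hu
      -- Writing `u` as a square `w ^ 2` makes the lift of `h(u)` a square `g * g`, so that its
      -- rotation has determinant `1` by `detFun_rho_mul_self`.
      obtain ⟨w₀, hw₀⟩ := IsAlgClosed.exists_pow_nat_eq (u : ℂ) (n := 2) (by norm_num)
      have hw₀0 : w₀ ≠ 0 := fun h => u.ne_zero (by rw [← hw₀, h, zero_pow two_ne_zero])
      obtain ⟨w, rfl⟩ : ∃ w : ℂˣ, (w : ℂ) = w₀ := ⟨Units.mk0 w₀ hw₀0, rfl⟩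
      have hw1 : ‖(w : ℂ)‖ = 1 := by
        have h : ‖(w : ℂ)‖ ^ 2 = 1 := by rw [← norm_pow, hw₀, hu1]
        exact (pow_eq_one_iff_of_nonneg (norm_nonneg _) two_ne_zero).mp h
      have hww : (w : ℂ) * starRingEnd ℂ (w : ℂ) = 1 := by
        rw [Complex.mul_conj', hw1]
        norm_num
      obtain ⟨g, hσ, hρ⟩ := KugaSatake.exists_sigma_eq_deligneHom hφ hω hω0 hK3 w w hww
        (by rw [pow_two, mul_assoc, hww, mul_one])
      have hρg : KugaSatake.rho φ (g * g) = H.deligneHom u := by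
        rw [map_mul, hρ, ← map_mul]
        exact congrArg _ (Units.ext (by rw [Units.val_mul, ← pow_two, hw₀]))
      rw [← hρg]
      refine ⟨⟨KugaSatake.rhoEnd_isometry φ (g * g) hs,
        KugaSatake.detFun_rho_mul_self hs hb hb0 g⟩, g * g, ?_, rfl⟩
      have hmem : KugaSatake.sigma φ g ∈
          (KugaSatake.kugaSatake φ H hφ ω hω hω0).mumfordTate :=
        hσ ▸ KugaSatake.subset_algebraicHull _ ⟨w, rfl⟩
      exact Subgroup.mem_comap.mpr (by rw [map_mul]; exact mul_mem hmem hmem)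
    rintro _ ⟨g, hg, rfl⟩
    -- `g'` is some lift of `ρ(g)` to the Mumford-Tate group; `g` itself lies there because the two
    -- have the same rotation.
    obtain ⟨-, g', hg', hgg'⟩ := hle hg
    exact KugaSatake.mem_of_rho_eq hs hb hb0 hM hhom hg' hgg'.symm
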